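/- **Setting.** Let $p$ be a prime, let $(R,\mathfrak m)$ be a regular local ring of characteristic $p$ that is $F$-finite (finite as a module over its subring $R^p$ of $p$-th powers), and let $q=p^e$ with $e\ge 0$. Let $(x_1,\dots,x_r,y_1,\dots,y_s)$ be an adapted $p$-basis of $R$: that is, $x_1,\dots,x_r$ is a regular system of parameters of $R$, and the monomials $x^{\alpha}y^{\beta}$ with $0\le\alpha_i,\beta_j<p$ form a basis of $R$ as an $R^p$-module. For an ideal $J\subseteq R$ put $\nu(J)=\sup\{n\in\mathbb N_0: J\subseteq\mathfrak m^n\}$ and for $g\in R$ put $\nu(g)=\nu(gR)$. For $f\in R$ let $$\nu^{(q)}(f)=\sup\{n\in\mathbb N_0: f\in R^q+\mathfrak m^n\}\in\mathbb N_0\cup\{\infty\}.$$ For $i\ge 0$ let $\operatorname{Diff}^i_{R,+}$ be the $R$-module of absolute (i.e. $\mathbb Z$-linear) differential operators $D:R\to R$ of order at most $i$ with $D(1)=0$; here $D$ has order at most $i$ if the map $R\otimes_{\mathbb Z} R\to R$, $r_1\otimes r_2\mapsto r_1D(r_2)$, annihilates $T^{i+1}$, where $T$ is the ideal generated by the elements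 $1\otimes r-r\otimes 1$. Let $\operatorname{Diff}^i_{R,+}(f)\subseteq R$ be the ideal generated by the values $D(f)$ with $D\in\operatorname{Diff}^i_{R,+}$, and let $$\eta(f)=\min\{\nu(\operatorname{Diff}^i_{R,+}(f))+i:\ i=1,\dots,q-1\}$$ (with $\eta(f)=\infty$ if $q=1$). The $q$-expansion of $f$ is the expression $f=\sum_{\alpha,\beta}c_{\alpha,\beta}^q x^{\alpha}y^{\beta}$ with $c_{\alpha,\beta}\in R$, the sum running over all $(\alpha,\beta)\in\mathbb N_0^{r+s}$ with all entries $<q$. **Lemma.** For every $f\in R$ one has $\nu^{(q)}(f)\le\eta(f)$. Assume now that $\nu^{(q)}(f)<\infty$ and write $\nu^{(q)}(f)=qa+b$ with $0\le b<q$. * Case 1. If $b>0$, then $\nu(\operatorname{Diff}^b_{R,+}(f))=qa$ and $\nu^{(q)}(f)=\eta(f)$. * Case 2. If $b=0$ and the $q$-expansion of $f$ has a term $c_{\alpha,\beta}^q x^{\alpha}y^{\beta}$ of order $\nu^{(q)}(f)$ with $\alpha\ne 0$, then $\nu(\operatorname{Diff}^{q-1}_{R,+}(f))<qa$ and $\nu^{(q)}(f)=\eta(f)$.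 * Case 3. If $b=0$ and every term $c_{\alpha,\beta}^q x^{\alpha}y^{\beta}$ with $(\alpha,\beta)\ne(0,0)$ of order $\nu^{(q)}(f)$ has $\alpha=0$, then $\nu(\operatorname{Diff}^{q-1}_{R,+}(f))\le qa$ and $qa=\nu^{(q)}(f)<\eta(f)<q(a+1)$. In particular, $qa+b=\nu^{(q)}(f)\le\eta(f)<q(a+1)$, and $\nu^{(q)}(f)=\eta(f)$ if $q\nmid\nu^{(q)}(f)$. -/

import Mathlib

open scoped TensorProduct

noncomputable section

/-- The ideal `T_R` of `R ⊗ R` (tensor product over a base ring `k`) generated by the elements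
`1 ⊗ r - r ⊗ 1`. -/
def diagonalIdeal (k R : Type*) [CommRing k] [CommRing R] [Algebra k R] : Ideal (R ⊗[k] R) :=
  Ideal.span (Set.range fun r : R => (1 : R) ⊗ₜ[k] r - r ⊗ₜ[k] (1 : R))

/-- The left `R`-linear extension `φ_D : R ⊗ R → R`, `r₁ ⊗ r₂ ↦ r₁ * D r₂`, of a `k`-linear
map `D : R → R`. -/
def leftExtension {k R : Type*} [CommRing k] [CommRing R] [Algebra k R] (D : R →ₗ[k] R) :
    R ⊗[k] R →ₗ[k] R :=
  LinearMap.mul' k R ∘ₗ LinearMap.lTensor R D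

theorem leftExtension_tmul {k R : Type*} [CommRing k] [CommRing R] [Algebra k R]
    (D : R →ₗ[k] R) (a b : R) : leftExtension D (a ⊗ₜ[k] b) = a * D b := by
  simp [leftExtension]

theorem leftExtension_zero {k R : Type*} [CommRing k] [CommRing R] [Algebra k R] :
    leftExtension (0 : R →ₗ[k] R) = 0 := by
  simp [leftExtension]

theorem leftExtension_add {k R : Type*} [CommRing k] [CommRing R] [Algebra k R]
    (D E : R →ₗ[k] R) : leftExtension (D + E) = leftExtension D + leftExtension E := by
  simp [leftExtension, LinearMap.lTensor_add, LinearMap.comp_add]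

theorem leftExtension_smul {k R : Type*} [CommRing k] [CommRing R] [Algebra k R]
    (c : R) (D : R →ₗ[k] R) (t : R ⊗[k] R) :
    leftExtension (c • D) t = c * leftExtension D t := by
  induction t with
  | zero => simp
  | tmul a b => simp only [leftExtension_tmul, LinearMap.smul_apply, smul_eq_mul]; ring
  | add s t hs ht => rw [map_add, map_add, hs, ht, mul_add]

/-- The `R`-module of `k`-linear differential operators of `R` of order at most `i`, i.e. of the
`k`-linear maps `D : R → R` whose left `R`-linear extension to `R ⊗ R` annihilates
`T_R ^ (i + 1)`. The absolute differential operators `Diff_R^i` are the case `k = ℤ`. -/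
def diffOp (k R : Type*) [CommRing k] [CommRing R] [Algebra k R] (i : ℕ) :
    Submodule R (R →ₗ[k] R) where
  carrier := {D | ∀ t ∈ diagonalIdeal k R ^ (i + 1), leftExtension D t = 0}
  zero_mem' := fun t _ => by rw [leftExtension_zero, LinearMap.zero_apply]
  add_mem' := fun {D E} hD hE t ht => by
    rw [leftExtension_add, LinearMap.add_apply, hD t ht, hE t ht, add_zero]
  smul_mem' := fun c D hD t ht => by rw [leftExtension_smul, hD t ht, mul_zero]

/-- The submodule of those differential operators `D` of order at most `i` with `D 1 = 0`;
`Diff_{R,+}^i` is the case `k = ℤ`. -/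
def diffOpPlus (k R : Type*) [CommRing k] [CommRing R] [Algebra k R] (i : ℕ) :
    Submodule R (R →ₗ[k] R) where
  carrier := {D | D ∈ diffOp k R i ∧ D 1 = 0}
  zero_mem' := ⟨zero_mem _, rfl⟩
  add_mem' := fun {D E} hD hE => ⟨add_mem hD.1 hE.1, by
    rw [LinearMap.add_apply, hD.2, hE.2, add_zero]⟩
  smul_mem' := fun c D hD => ⟨Submodule.smul_mem _ c hD.1, by
    rw [LinearMap.smul_apply, hD.2, smul_zero]⟩

/-- The ideal `Diff_{R,+}^i(f)` generated by (in fact, equal to the set of) the values `D f` of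
the absolute differential operators `D ∈ Diff_{R,+}^i`. -/
def diffPlusIdeal {R : Type*} [CommRing R] (i : ℕ) (f : R) : Ideal R :=
  Ideal.span {g | ∃ D ∈ diffOpPlus ℤ R i, g = D f}

/-- The order `ν_m(J)` of an ideal `J` of a local ring `(R, m)`: the supremum in `ℕ ∪ {∞}` of
the integers `n` with `J ⊆ m ^ n`. -/
def idealOrder {R : Type*} [CommRing R] [IsLocalRing R] (J : Ideal R) : ℕ∞ :=
  ⨆ (n : ℕ) (_ : J ≤ IsLocalRing.maximalIdeal R ^ n), (n : ℕ∞)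

/-- The order `ν_m(f)` of an element `f` of a local ring `(R, m)`. -/
def elemOrder {R : Type*} [CommRing R] [IsLocalRing R] (f : R) : ℕ∞ :=
  ⨆ (n : ℕ) (_ : f ∈ IsLocalRing.maximalIdeal R ^ n), (n : ℕ∞)

/-- The `q`-order `ν_m^{(q)}(f)`: the supremum in `ℕ ∪ {∞}` of the integers `n` with
`f ∈ R^q + m ^ n`, where `R^q` is the set of `q`-th powers. -/
def qOrder {R : Type*} [CommRing R] [IsLocalRing R] (q : ℕ) (f : R) : ℕ∞ :=
  ⨆ (n : ℕ) (_ : ∃ g : R, ∃ h ∈ IsLocalRing.maximalIdeal R ^ n, f = g ^ q + h), (n : ℕ∞)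

/-- `η_m(f)`: the minimum of `ν_m(Diff_{R,+}^i(f)) + i` over `i = 1, …, q - 1`
(`∞` when `q = 1`, where there is no such `i`). -/
def etaOrder {R : Type*} [CommRing R] [IsLocalRing R] (q : ℕ) (f : R) : ℕ∞ :=
  ⨅ i ∈ Finset.Icc 1 (q - 1), (idealOrder (diffPlusIdeal i f) + (i : ℕ∞))

/-- A finite family `z` in a ring `R` of characteristic `p` is a `p`-basis if the monomials
`∏ i, z i ^ α i` with `0 ≤ α i < p` form a basis of `R` over the subring `R^p`. -/
def IsPBasis (p : ℕ) {R : Type*} [CommRing R] [ExpChar R p] {ι : Type*} [Fintype ι]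
    (z : ι → R) : Prop :=
  LinearIndependent (frobenius R p).range (fun α : ι → Fin p => ∏ i, z i ^ (α i : ℕ)) ∧
    Submodule.span (frobenius R p).range
      (Set.range fun α : ι → Fin p => ∏ i, z i ^ (α i : ℕ)) = ⊤

/-- `x` is a regular system of parameters of the local ring `R`: it generates the maximal ideal
and has `dim R` members. -/
def IsRegularParameterSystem {R : Type*} [CommRing R] [IsLocalRing R] {r : ℕ}
    (x : Fin r → R) : Prop :=
  Ideal.span (Set.range x) = IsLocalRing.maximalIdeal R ∧ ringKrullDim R = (r : WithBot ℕ∞)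

/-- `(x, y)` is an adapted `p`-basis of `(R, m)`: a `p`-basis of `R` that extends the regular
system of parameters `x`. -/
def IsAdaptedPBasis (p : ℕ) {R : Type*} [CommRing R] [IsLocalRing R] [ExpChar R p] {r s : ℕ}
    (x : Fin r → R) (y : Fin s → R) : Prop :=
  IsRegularParameterSystem x ∧ IsPBasis p (Sum.elim x y)

/-- The term `c ^ q * x ^ α * y ^ β` of a `q`-expansion. -/
def qTerm {R : Type*} [CommRing R] {q r s : ℕ} (x : Fin r → R) (y : Fin s → R)
    (c : (Fin r → Fin q) → (Fin s → Fin q) → R) (α : Fin r → Fin q) (β : Fin s → Fin q) : R :=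
  c α β ^ q * (∏ i, x i ^ (α i : ℕ)) * ∏ j, y j ^ (β j : ℕ)

/-- The family `c` consists of the coefficients of the `q`-expansion of `f` with respect to
`(x, y)`: `f` is the sum of the terms `c α β ^ q * x ^ α * y ^ β` over all multi-indices with
entries in `{0, …, q - 1}`. -/
def IsQExpansion {R : Type*} [CommRing R] {q r s : ℕ} (x : Fin r → R) (y : Fin s → R) (f : R)
    (c : (Fin r → Fin q) → (Fin s → Fin q) → R) : Prop :=
  f = ∑ α : Fin r → Fin q, ∑ β : Fin s → Fin q, qTerm x y c α β

end

/-!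
Write `q = p ^ e`, `z = (x, y)` and let `m` be the maximal ideal. Everything rests on two properties
of the `q`-expansion `f = ∑ c α ^ q * z ^ α`.

*Orders are read off term by term.* If the sum lies in `m ^ n`, so does every single term
(`exists_coeff_mem_pow_of_qSum_mem_pow`), and the order of a term is `q * ν(c α)` plus the degree of
`α` in `x`. The proof refines the expansion to exponents `< q * p ^ n`: for such a fine expansion,
lying in `m ^ n` just means that the coefficients of the monomials of `x`-degree `< n` are in `m`
(`coeff_mem_of_qSum_mem_pow`). Subtracting a `q`-th power only changes the term with `α = 0`, so
`ν^(q)(f)` is the least order of a term with `α ≠ 0`.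

*Hasse operators act diagonally.* The map `D_γ` that is linear over `q`-th powers and sends `z ^ α` to
`(α choose γ) * z ^ (α - γ)` is a differential operator of order `|γ|` (`hasseOp_mem_diffOp`): by
Pascal's rule its commutator with `z j` is `D_{γ - e_j}`, so induction on the order applies. It moves
different terms to different monomials, hence a term whose binomial coefficient is nonzero modulo `p`
bounds the order of `D_γ f` (`idealOrder_diffPlusIdeal_le`).

The lower bounds on the orders of the ideals hold because an operator of order `i < q` is linear over
`q`-th powers and maps `m ^ n` into `m ^ (n - i)`. For the upper bounds, a term of minimal order is
hit by a suitable `D_γ`. If `q ∤ ν^(q)(f)` with remainder `b`, the `x`-degree of this term is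
congruent to `b` modulo `q`, and Vandermonde's identity together with
`(q * k + b choose b) ≡ 1 mod p` provides a `γ` in the `x`-variables with `|γ| = b`. Otherwise a `γ`
supported on one variable suffices: an `x`-variable lowers the order, whereas a `y`-variable does
not, which is why the inequality becomes strict in the last case.

That the `p`-basis yields unique expansions for all `p ^ e` needs the Frobenius to be injective; it
holds as a regular local ring is a domain (`isDomain_of_span_finset_eq_maximalIdeal`).
-/

/-! ### Regular local rings are domains -/

open IsLocalRing in
/-- A Noetherian local ring whose maximal ideal is generated by at most `n ≤ dim R` elements is a
domain. By prime avoidance there is `a ∈ m` outside `m ^ 2` and all minimal primes. As `a` can replace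
one of the generators, induction shows that `R ⧸ (a)` is a domain. A minimal prime `Q ⊆ (a)` satisfies
`Q = a Q`, so it vanishes by Nakayama's lemma. -/
theorem isDomain_of_span_finset_eq_maximalIdeal (n : ℕ) :
    ∀ (R : Type*) [CommRing R] [IsLocalRing R] [IsNoetherianRing R] (S : Finset R),
      S.card ≤ n → Ideal.span (S : Set R) = maximalIdeal R → (n : WithBot ℕ∞) ≤ ringKrullDim R →
      IsDomain R := by
  induction n with
  | zero =>
    intro R _ _ _ S hS hm _
    have hS0 : S = ∅ := Finset.card_eq_zero.mp (Nat.le_zero.mp hS)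
    have hf : IsField R := by
      rw [IsLocalRing.isField_iff_maximalIdeal_eq, ← hm, hS0]
      simp
    exact hf.isDomain
  | succ n ih =>
    intro R _ _ _ S hS hm hdim
    classical
    have hht : ((maximalIdeal R).height : WithBot ℕ∞) = ringKrullDim R :=
      IsLocalRing.maximalIdeal_height_eq_ringKrullDim
    have hpos : (maximalIdeal R).height ≠ 0 := by
      intro h0
      rw [← hht, h0] at hdim
      have h1 : ((n + 1 : ℕ) : ℕ∞) ≤ 0 := by exact_mod_cast hdim
      simp at h1
    have hmin : maximalIdeal R ∉ minimalPrimes R := by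
      intro h
      exact hpos (Ideal.height_eq_zero_iff.mpr h)
    obtain ⟨a, ham, hav⟩ : ∃ a ∈ maximalIdeal R,
        a ∉ maximalIdeal R ^ 2 ∧ ∀ P ∈ minimalPrimes R, a ∉ P := by
      by_contra! hcon
      have hfin : (minimalPrimes R).Finite := minimalPrimes.finite_of_isNoetherianRing R
      have hsub : ((maximalIdeal R : Ideal R) : Set R) ⊆
          ⋃ I ∈ (insert (maximalIdeal R ^ 2) (minimalPrimes R) : Set (Ideal R)), (I : Set R) := by
        intro b hb
        by_cases hb2 : b ∈ maximalIdeal R ^ 2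
        · exact Set.mem_biUnion (Set.mem_insert _ _) hb2
        · obtain ⟨P, hP, hbP⟩ := hcon b hb hb2
          exact Set.mem_biUnion (Set.mem_insert_of_mem _ hP) hbP
      obtain ⟨I, hI, hle⟩ := (Ideal.subset_union_prime_finite (f := id)
        (hfin.insert (maximalIdeal R ^ 2)) (maximalIdeal R ^ 2) (maximalIdeal R ^ 2)
        (fun I hI hne _ => (hI.resolve_left hne).1.1)).1 hsub
      rcases hI with rfl | hI
      · have hbot : maximalIdeal R = ⊥ := by
          apply Submodule.eq_bot_of_le_smul_of_le_jacobson_bot (maximalIdeal R) (maximalIdeal R)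
            (IsNoetherian.noetherian _)
          · simpa [pow_two] using hle
          · exact maximalIdeal_le_jacobson _
        apply hpos
        rw [hbot] at *
        simp
      · have hI' : (I : Ideal R) = maximalIdeal R :=
          le_antisymm (le_maximalIdeal hI.1.1.ne_top) hle
        exact hmin (hI' ▸ hI)
    obtain ⟨ha2, haP⟩ := hav
    obtain ⟨u, hu⟩ : ∃ u : R → R, ∑ s ∈ S, u s * s = a := by
      rw [← hm] at ham
      obtain ⟨u, -, hu⟩ := Submodule.mem_span_finset.mp ham
      exact ⟨u, hu⟩
    have hSm : ∀ s ∈ S, s ∈ maximalIdeal R := fun s hs => hm ▸ Ideal.subset_span hs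
    -- since `a ∉ m ^ 2`, some coefficient is a unit, and `a` can replace that generator
    obtain ⟨s, hs, hus⟩ : ∃ s ∈ S, IsUnit (u s) := by
      by_contra! hcon
      apply ha2
      rw [← hu, pow_two]
      exact Ideal.sum_mem _ fun s hs => Ideal.mul_mem_mul (hcon s hs) (hSm s hs)
    have hle : Ideal.span {a} ≤ maximalIdeal R := by
      rwa [Ideal.span_singleton_le_iff_mem]
    have hne : Ideal.span {a} ≠ ⊤ := fun h => (maximalIdeal.isMaximal R).ne_top (top_le_iff.mp (h ▸ hle))
    have : Nontrivial (R ⧸ Ideal.span {a}) := Ideal.Quotient.nontrivial_iff.mpr hne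
    have : IsLocalRing (R ⧸ Ideal.span {a}) :=
      IsLocalRing.of_surjective' (Ideal.Quotient.mk _) Ideal.Quotient.mk_surjective
    have hdom : IsDomain (R ⧸ Ideal.span {a}) := by
      refine ih (R ⧸ Ideal.span {a}) ((S.erase s).image (Ideal.Quotient.mk _)) ?_ ?_ ?_
      · refine Finset.card_image_le.trans ?_
        rw [Finset.card_erase_of_mem hs]
        omega
      · rw [← map_maximalIdeal_of_surjective (Ideal.Quotient.mk (Ideal.span {a}))
          Ideal.Quotient.mk_surjective, ← hm, Finset.coe_image, ← Ideal.map_span]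
        apply le_antisymm
        · exact Ideal.map_mono (Ideal.span_mono (Finset.coe_subset.mpr (Finset.erase_subset s S)))
        · rw [Ideal.map_span, Ideal.span_le]
          rintro _ ⟨t, ht, rfl⟩
          by_cases hts : t = s
          · subst hts
            have hsum := Finset.add_sum_erase S (fun s => u s * s) ht
            have ha0 : Ideal.Quotient.mk (Ideal.span {a}) a = 0 :=
              Ideal.Quotient.eq_zero_iff_mem.mpr (Ideal.mem_span_singleton_self a)
            obtain ⟨v, hv⟩ := hus
            have key : t = (↑v⁻¹ : R) * (a - ∑ x ∈ S.erase t, u x * x) := by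
              rw [← hu, ← hsum, ← hv]; simp
            rw [SetLike.mem_coe, congrArg (Ideal.Quotient.mk (Ideal.span {a})) key, map_mul, map_sub, ha0, zero_sub]
            refine Ideal.mul_mem_left _ _ (neg_mem ?_)
            exact Ideal.mem_map_of_mem _ (Ideal.sum_mem _ fun x hx =>
              Ideal.mul_mem_left _ _ (Ideal.subset_span hx))
          · exact Ideal.mem_map_of_mem _ (Ideal.subset_span (Finset.mem_erase.mpr ⟨hts, ht⟩))
      · -- dividing by one element lowers the dimension by at most one
        have h1 := ringKrullDim_le_ringKrullDim_quotient_add_card (R := R) {a}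
          (by rw [IsLocalRing.ringJacobson_eq_maximalIdeal]; simpa using ham)
        rw [Finset.coe_singleton, Finset.card_singleton] at h1
        have h2 := hdim.trans h1
        push_cast at h2
        generalize ringKrullDim (R ⧸ Ideal.span {a}) = d at h2
        induction d using WithBot.recBotCoe with
        | bot => exact absurd h2 (by
            rw [WithBot.bot_add, le_bot_iff]; exact WithBot.coe_ne_bot)
        | coe d =>
          have h3 : ((n : ℕ∞) + 1) ≤ d + 1 := by exact_mod_cast h2
          have h4 : (n : ℕ∞) ≤ d := (ENat.add_le_add_iff_right (by simp)).mp h3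
          exact_mod_cast h4
    have hprime : (Ideal.span {a}).IsPrime := (Ideal.Quotient.isDomain_iff_prime _).mp hdom
    obtain ⟨Q, hQ, hQa⟩ := Ideal.exists_minimalPrimes_le (I := (⊥ : Ideal R)) (J := Ideal.span {a}) bot_le
    have hQbot : Q = ⊥ := by
      apply Submodule.eq_bot_of_le_smul_of_le_jacobson_bot (Ideal.span {a}) Q
        (IsNoetherian.noetherian _)
      · intro b hb
        obtain ⟨t, rfl⟩ := Ideal.mem_span_singleton'.mp (hQa hb)
        rw [mul_comm]
        exact Ideal.mul_mem_mul (Ideal.mem_span_singleton_self a)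
          ((hQ.1.1.mem_or_mem hb).resolve_right (haP Q hQ))
      · exact hle.trans (maximalIdeal_le_jacobson _)
    have : (⊥ : Ideal R).IsPrime := hQbot ▸ hQ.1.1
    exact IsDomain.of_bot_isPrime R

/-! ### Expansions with respect to `q`-th powers -/

section QExpansions

variable {R ι : Type*} [CommRing R] [Fintype ι]

/-- The monomial `z ^ α`. -/
def monom (z : ι → R) (α : ι → ℕ) : R := ∏ i, z i ^ α i

theorem monom_zero (z : ι → R) : monom z 0 = 1 := by simp [monom]

theorem monom_add (z : ι → R) (α β : ι → ℕ) : monom z (α + β) = monom z α * monom z β := by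
  simp [monom, pow_add, Finset.prod_mul_distrib]

theorem monom_pow (z : ι → R) (α : ι → ℕ) (n : ℕ) : monom z α ^ n = monom z (n • α) := by
  simp only [monom, ← Finset.prod_pow, ← pow_mul, Pi.smul_apply, smul_eq_mul, mul_comm n]

variable [DecidableEq ι]

/-- The multi-indices `α : ι → ℕ` with all entries `< q`. -/
def expBox (ι : Type*) [Fintype ι] [DecidableEq ι] (q : ℕ) : Finset (ι → ℕ) :=
  Fintype.piFinset fun _ => Finset.range q

theorem mem_expBox {q : ℕ} {α : ι → ℕ} : α ∈ expBox ι q ↔ ∀ i, α i < q := by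
  simp [expBox]

/-- The sum `∑ c α ^ q * z ^ α` over all multi-indices with entries `< q`. The family `c` is
defined on all multi-indices, but only its values on `expBox ι q` matter. -/
def qSum (q : ℕ) (z : ι → R) (c : (ι → ℕ) → R) : R :=
  ∑ α ∈ expBox ι q, c α ^ q * monom z α

/-- The monomials `z ^ α` with exponents `< q` form a basis of `R` over its subring of `q`-th powers,
and the `q`-th power map is injective: every element has exactly one `q`-expansion. -/
structure IsQBasis (q : ℕ) (z : ι → R) : Prop where
  exists_eq_qSum : ∀ f, ∃ c, f = qSum q z c
  eq_zero_of_qSum_eq_zero : ∀ c, qSum q z c = 0 → ∀ α ∈ expBox ι q, c α = 0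

theorem qSum_single {q : ℕ} (hq : q ≠ 0) (z : ι → R) {α : ι → ℕ}
    (hα : α ∈ expBox ι q) (g : R) : qSum q z (Pi.single α g) = g ^ q * monom z α := by
  rw [qSum, Finset.sum_eq_single_of_mem α hα]
  · rw [Pi.single_eq_same]
  · intro β _ hβ
    rw [Pi.single_eq_of_ne hβ, zero_pow hq, zero_mul]

theorem qSum_eq_pow_add {q : ℕ} (hq : 0 < q) (z : ι → R) (c : (ι → ℕ) → R) :
    qSum q z c = c 0 ^ q + ∑ α ∈ (expBox ι q).erase 0, c α ^ q * monom z α := by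
  have h0 : (0 : ι → ℕ) ∈ expBox ι q := mem_expBox.mpr fun _ => hq
  rw [qSum, ← Finset.add_sum_erase _ _ h0, monom_zero, mul_one]

theorem qSum_congr {q : ℕ} {z : ι → R} {c d : (ι → ℕ) → R} (h : ∀ α ∈ expBox ι q, c α = d α) :
    qSum q z c = qSum q z d :=
  Finset.sum_congr rfl fun α hα => by rw [h α hα]

/-- Division with remainder by `q` in every entry of the multi-index. -/
theorem sum_expBox_mul {M : Type*} [AddCommMonoid M] {q q' : ℕ} (hq : 0 < q)
    (F : (ι → ℕ) → M) :
    ∑ γ ∈ expBox ι (q * q'), F γ = ∑ α ∈ expBox ι q, ∑ β ∈ expBox ι q', F (α + q • β) := by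
  rw [← Finset.sum_product']
  refine Finset.sum_nbij' (fun γ => (fun i => γ i % q, fun i => γ i / q))
    (fun αβ => αβ.1 + q • αβ.2) ?_ ?_ ?_ ?_ ?_
  · intro γ hγ
    rw [mem_expBox] at hγ
    simp only [Finset.mem_product, mem_expBox]
    exact ⟨fun i => Nat.mod_lt _ hq, fun i => Nat.div_lt_of_lt_mul (hγ i)⟩
  · rintro ⟨α, β⟩ h
    simp only [Finset.mem_product, mem_expBox] at h
    rw [mem_expBox]
    intro i
    calc α i + q * β i < q + q * β i := by have := h.1 i; omega
      _ = q * (β i + 1) := by ring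
      _ ≤ q * q' := Nat.mul_le_mul_left _ (h.2 i)
  · intro γ _
    ext i
    exact Nat.mod_add_div _ _
  · rintro ⟨α, β⟩ h
    simp only [Finset.mem_product, mem_expBox] at h
    ext i
    · simp [Nat.add_mul_mod_self_left, Nat.mod_eq_of_lt (h.1 i)]
    · simp [Nat.add_mul_div_left _ _ hq, Nat.div_eq_of_lt (h.1 i)]
  · intro γ _
    congr 1
    ext i
    exact (Nat.mod_add_div _ _).symm

section ExpChar

variable (p : ℕ) [ExpChar R p]

theorem qSum_add (e : ℕ) (z : ι → R) (c d : (ι → ℕ) → R) :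
    qSum (p ^ e) z (c + d) = qSum (p ^ e) z c + qSum (p ^ e) z d := by
  simp only [qSum, Pi.add_apply, add_pow_expChar_pow, add_mul, Finset.sum_add_distrib]

theorem qSum_sub (e : ℕ) (z : ι → R) (c d : (ι → ℕ) → R) :
    qSum (p ^ e) z (c - d) = qSum (p ^ e) z c - qSum (p ^ e) z d := by
  simp only [qSum, Pi.sub_apply, sub_pow_expChar_pow, sub_mul, Finset.sum_sub_distrib]

theorem pow_qSum (e q' : ℕ) (z : ι → R) (c : (ι → ℕ) → R) :
    qSum q' z c ^ p ^ e =
      ∑ α ∈ expBox ι q', c α ^ (p ^ e * q') * monom z (p ^ e • α) := by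
  rw [qSum, sum_pow_char_pow]
  refine Finset.sum_congr rfl fun α _ => ?_
  rw [mul_pow, monom_pow, ← pow_mul, mul_comm q']

/-- A `p ^ e * q'`-expansion is a `p ^ e`-expansion whose coefficients are `q'`-expansions. -/
theorem qSum_mul_eq (e q' : ℕ) (z : ι → R) (d : (ι → ℕ) → R) :
    qSum (p ^ e * q') z d =
      qSum (p ^ e) z fun α => qSum q' z fun β => d (α + p ^ e • β) := by
  rw [qSum, sum_expBox_mul (pow_pos (expChar_pos R p) e), qSum]
  refine Finset.sum_congr rfl fun α _ => ?_
  rw [pow_qSum, Finset.sum_mul]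
  refine Finset.sum_congr rfl fun β _ => ?_
  rw [monom_add]
  ring

theorem exists_forall_add_smul_eq {q : ℕ} {S : Type*} (d : (ι → ℕ) → (ι → ℕ) → S) :
    ∃ d' : (ι → ℕ) → S, ∀ α ∈ expBox ι q, ∀ β, d' (α + q • β) = d α β := by
  refine ⟨fun γ => d (fun i => γ i % q) fun i => γ i / q, fun α hα β => ?_⟩
  rw [mem_expBox] at hα
  have h1 : (fun i => (α + q • β) i % q) = α := by
    ext i
    simp [Nat.add_mul_mod_self_left, Nat.mod_eq_of_lt (hα i)]
  have h2 : (fun i => (α + q • β) i / q) = β := by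
    ext i
    simp [Nat.add_mul_div_left _ _ (Nat.zero_lt_of_lt (hα i)), Nat.div_eq_of_lt (hα i)]
  simp only [h1, h2]

variable {p}

theorem IsQBasis.eq_of_qSum_eq {e : ℕ} {z : ι → R} (h : IsQBasis (p ^ e) z) {c d : (ι → ℕ) → R}
    (hcd : qSum (p ^ e) z c = qSum (p ^ e) z d) : ∀ α ∈ expBox ι (p ^ e), c α = d α := by
  intro α hα
  have := h.eq_zero_of_qSum_eq_zero (c - d) (by rw [qSum_sub, hcd, sub_self]) α hα
  exact sub_eq_zero.mp this

/-- The coefficients of a `q`-expansion can be expanded further, with one family `d` of coefficients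
on the box of multi-indices of size `q * q'`. -/
theorem IsQBasis.exists_refinement {q q' : ℕ} {z : ι → R} (h' : IsQBasis q' z)
    (c : (ι → ℕ) → R) : ∃ d : (ι → ℕ) → R, ∀ α ∈ expBox ι q,
      c α = qSum q' z fun β => d (α + q • β) := by
  choose d hd using fun α => h'.exists_eq_qSum (c α)
  obtain ⟨d', hd'⟩ := exists_forall_add_smul_eq (q := q) d
  refine ⟨d', fun α hα => ?_⟩
  simp only [hd' α hα]
  exact hd α

theorem IsQBasis.mul {e q' : ℕ} {z : ι → R} (h : IsQBasis (p ^ e) z) (h' : IsQBasis q' z) :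
    IsQBasis (p ^ e * q') z where
  exists_eq_qSum f := by
    obtain ⟨c, hc⟩ := h.exists_eq_qSum f
    obtain ⟨d, hd⟩ := h'.exists_refinement (q := p ^ e) c
    exact ⟨d, by rw [qSum_mul_eq, hc]; exact qSum_congr hd⟩
  eq_zero_of_qSum_eq_zero d hd γ hγ := by
    rw [qSum_mul_eq] at hd
    have h1 := h.eq_zero_of_qSum_eq_zero _ hd
    have hq : 0 < p ^ e := pow_pos (expChar_pos R p) e
    rw [mem_expBox] at hγ
    have h2 := h'.eq_zero_of_qSum_eq_zero _
      (h1 (fun i => γ i % p ^ e) (mem_expBox.mpr fun i => Nat.mod_lt _ hq))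
      (fun i => γ i / p ^ e) (mem_expBox.mpr fun i => Nat.div_lt_of_lt_mul (hγ i))
    convert h2 using 2
    ext i
    exact (Nat.mod_add_div _ _).symm

theorem isQBasis_one (z : ι → R) : IsQBasis 1 z := by
  have hbox : expBox ι 1 = {0} := by
    ext α
    simp [mem_expBox, funext_iff]
  refine ⟨fun f => ⟨fun _ => f, by simp [qSum, hbox, monom_zero]⟩, fun c hc α hα => ?_⟩
  rw [hbox, Finset.mem_singleton] at hα
  simpa [qSum, hbox, monom_zero, hα] using hc

theorem IsQBasis.pow {z : ι → R} (h : IsQBasis p z) : ∀ e : ℕ, IsQBasis (p ^ e) z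
  | 0 => by simpa using isQBasis_one z
  | e + 1 => by
    rw [pow_succ]
    exact (IsQBasis.pow h e).mul h

theorem sum_fin_eq_sum_expBox {M : Type*} [AddCommMonoid M] (q : ℕ) (F : (ι → ℕ) → M) :
    ∑ α : ι → Fin q, F (fun i => α i) = ∑ α ∈ expBox ι q, F α := by
  refine Finset.sum_bij' (fun α _ i => (α i : ℕ))
    (fun α hα i => ⟨α i, mem_expBox.mp hα i⟩) ?_ ?_ ?_ ?_ ?_
  · intro α _
    exact mem_expBox.mpr fun i => (α i).isLt
  · intros; exact Finset.mem_univ _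
  · intros; rfl
  · intros; rfl
  · intros; rfl

/-- Reducedness turns linear independence over the subring `R ^ p` into uniqueness of the
coefficients before taking `p`-th powers. -/
theorem IsPBasis.isQBasis [IsReduced R] {z : ι → R} (h : IsPBasis p z) : IsQBasis p z where
  exists_eq_qSum f := by
    have hf : f ∈ Submodule.span (frobenius R p).range
        (Set.range fun α : ι → Fin p => ∏ i, z i ^ (α i : ℕ)) := h.2 ▸ Submodule.mem_top
    obtain ⟨a, ha⟩ := (Submodule.mem_span_range_iff_exists_fun _).mp hf
    choose b hb using fun α => (a α).2
    refine ⟨fun α => if hα : ∀ i, α i < p then b fun i => ⟨α i, hα i⟩ else 0, ?_⟩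
    rw [← ha, qSum, ← sum_fin_eq_sum_expBox]
    refine Finset.sum_congr rfl fun α _ => ?_
    rw [dif_pos fun i => (α i).isLt]
    change (a α : R) * _ = _
    rw [← hb α]
    rfl
  eq_zero_of_qSum_eq_zero c hc α hα := by
    rw [qSum, ← sum_fin_eq_sum_expBox] at hc
    have h0 := Fintype.linearIndependent_iff.mp h.1
      (fun α => ⟨frobenius R p (c fun i => α i), ⟨_, rfl⟩⟩) hc
    have h1 := h0 fun i => ⟨α i, mem_expBox.mp hα i⟩
    have h2 : c α ^ p = 0 := congrArg Subtype.val h1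
    exact eq_zero_of_pow_eq_zero h2

end ExpChar

end QExpansions

/-! ### Differential operators and commutators -/

section DiffOps

open scoped TensorProduct

variable {k R : Type*} [CommRing k] [CommRing R] [Algebra k R]

/-- The commutator `[D, a] : f ↦ D (a * f) - a * D f`. -/
def opCommutator (D : R →ₗ[k] R) (a : R) : R →ₗ[k] R :=
  D ∘ₗ LinearMap.mulLeft k a - a • D

theorem opCommutator_apply (D : R →ₗ[k] R) (a f : R) :
    opCommutator D a f = D (a * f) - a * D f := rfl

theorem leftExtension_comp_mulLeft (D : R →ₗ[k] R) (b : R) (t : R ⊗[k] R) :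
    leftExtension (D ∘ₗ LinearMap.mulLeft k b) t = leftExtension D ((1 ⊗ₜ b) * t) := by
  induction t with
  | zero => simp
  | tmul x y => simp [leftExtension_tmul]
  | add s t hs ht => rw [map_add, mul_add, map_add, hs, ht]

theorem leftExtension_tmul_one_mul (D : R →ₗ[k] R) (a : R) (t : R ⊗[k] R) :
    leftExtension D ((a ⊗ₜ 1) * t) = a * leftExtension D t := by
  induction t with
  | zero => simp
  | tmul x y => simp [leftExtension_tmul, mul_assoc]
  | add s t hs ht => rw [map_add, mul_add, map_add, hs, ht, mul_add]

theorem leftExtension_opCommutator (D : R →ₗ[k] R) (a : R) (t : R ⊗[k] R) :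
    leftExtension (opCommutator D a) t =
      leftExtension D ((1 ⊗ₜ a - a ⊗ₜ 1) * t) := by
  have h : D ∘ₗ LinearMap.mulLeft k a = opCommutator D a + a • D := by
    simp [opCommutator]
  have h2 := leftExtension_comp_mulLeft D a t
  rw [h, leftExtension_add, LinearMap.add_apply, leftExtension_smul] at h2
  rw [sub_mul, map_sub, leftExtension_tmul_one_mul, ← h2, add_sub_cancel_right]

theorem diffOp_comp_mulLeft {i : ℕ} {D : R →ₗ[k] R} (hD : D ∈ diffOp k R i) (b : R) :
    D ∘ₗ LinearMap.mulLeft k b ∈ diffOp k R i := fun t ht => by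
  rw [leftExtension_comp_mulLeft]
  exact hD _ (Ideal.mul_mem_left _ _ ht)

theorem diffOp_mono {i j : ℕ} (hij : i ≤ j) : diffOp k R i ≤ diffOp k R j :=
  fun _ hD t ht => hD t (Ideal.pow_le_pow_right (by omega) ht)

/-- To vanish on `T * I`, with `T` the diagonal ideal, it suffices to vanish on the products of the
generators of `T` with elements of `I`. -/
theorem leftExtension_eq_zero_of_forall {D : R →ₗ[k] R} {I : Ideal (R ⊗[k] R)}
    (h : ∀ a, ∀ t ∈ I, leftExtension D ((1 ⊗ₜ a - a ⊗ₜ 1) * t) = 0) :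
    ∀ t ∈ diagonalIdeal k R * I, leftExtension D t = 0 := by
  intro t ht
  induction ht using Submodule.mul_induction_on' with
  | mem_mul_mem m hm n hn =>
    rw [diagonalIdeal] at hm
    induction hm using Submodule.span_induction generalizing n with
    | mem x hx =>
      obtain ⟨a, rfl⟩ := hx
      exact h a n hn
    | zero => simp
    | add x y _ _ hx hy => rw [add_mul, map_add, hx n hn, hy n hn, add_zero]
    | smul c x _ hx =>
      rw [smul_eq_mul, mul_comm c, mul_assoc]
      exact hx _ (Ideal.mul_mem_left _ _ hn)
  | add x _ y _ hx hy => rw [map_add, hx, hy, add_zero]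

theorem one_tmul_sub_mem_diagonalIdeal (a : R) :
    (1 : R) ⊗ₜ[k] a - a ⊗ₜ[k] (1 : R) ∈ diagonalIdeal k R :=
  Ideal.subset_span ⟨a, rfl⟩

/-- Grothendieck's recursive description of the order of a differential operator. -/
theorem mem_diffOp_succ_iff {i : ℕ} {D : R →ₗ[k] R} :
    D ∈ diffOp k R (i + 1) ↔ ∀ a, opCommutator D a ∈ diffOp k R i := by
  constructor
  · intro hD a t ht
    rw [leftExtension_opCommutator]
    apply hD
    rw [pow_succ' _ (i + 1)]
    exact Ideal.mul_mem_mul (one_tmul_sub_mem_diagonalIdeal a) ht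
  · intro h t ht
    rw [pow_succ' _ (i + 1)] at ht
    refine leftExtension_eq_zero_of_forall (fun a t ht => ?_) t ht
    rw [← leftExtension_opCommutator]
    exact h a t ht

theorem mem_diffOp_zero_iff {D : R →ₗ[k] R} :
    D ∈ diffOp k R 0 ↔ ∀ a, opCommutator D a = 0 := by
  constructor
  · intro hD a
    ext f
    have hmem : ((1 : R) ⊗ₜ[k] a - a ⊗ₜ[k] (1 : R)) * ((1 : R) ⊗ₜ[k] f) ∈
        diagonalIdeal k R ^ (0 + 1) := by
      rw [zero_add, pow_one]
      exact Ideal.mul_mem_right _ _ (one_tmul_sub_mem_diagonalIdeal a)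
    have := hD _ hmem
    rw [← leftExtension_opCommutator, leftExtension_tmul, one_mul] at this
    exact this
  · intro h t ht
    rw [zero_add, pow_one, ← mul_one (diagonalIdeal k R), Ideal.one_eq_top] at ht
    refine leftExtension_eq_zero_of_forall (fun a t ht => ?_) t ht
    rw [← leftExtension_opCommutator, h a, leftExtension_zero, LinearMap.zero_apply]

/-- A differential operator of order at most `i` lowers the `I`-adic order by at most `i`. -/
theorem diffOp_apply_mem_pow (I : Ideal R) : ∀ (i n : ℕ) {D : R →ₗ[k] R}, D ∈ diffOp k R i →
    ∀ f ∈ I ^ n, D f ∈ I ^ (n - i) := by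
  intro i
  induction i with
  | zero =>
    intro n D hD f hf
    have h := mem_diffOp_zero_iff.mp hD f
    have h1 : D (f * 1) - f * D 1 = 0 := by
      rw [← opCommutator_apply, h, LinearMap.zero_apply]
    rw [mul_one] at h1
    rw [sub_eq_zero.mp h1]
    exact Ideal.mul_mem_right _ _ hf
  | succ i ihi =>
    intro n
    induction n with
    | zero => intro D _ f _; simp
    | succ n ihn =>
      intro D hD f hf
      rw [Nat.add_sub_add_right]
      rw [pow_succ'] at hf
      induction hf using Submodule.mul_induction_on' with
      | mem_mul_mem a ha g hg =>
        have h1 : D (a * g) = opCommutator D a g + a * D g := by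
          rw [opCommutator_apply]; ring
        rw [h1]
        refine add_mem (ihi n (mem_diffOp_succ_iff.mp hD a) g hg) ?_
        have h2 := Ideal.mul_mem_mul ha (ihn hD g hg)
        rw [← pow_succ'] at h2
        exact Ideal.pow_le_pow_right (by omega) h2
      | add x _ y _ hx hy => rw [map_add]; exact add_mem hx hy

/-- Operators of order less than `p ^ e` are linear over the `p ^ e`-th powers, because
`(1 ⊗ g - g ⊗ 1) ^ p ^ e = 1 ⊗ g ^ p ^ e - g ^ p ^ e ⊗ 1`. -/
theorem diffOp_pow_mul (p : ℕ) [ExpChar R p] [ExpChar (R ⊗[k] R) p] {e i : ℕ} (hi : i < p ^ e)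
    {D : R →ₗ[k] R} (hD : D ∈ diffOp k R i) (g h : R) : D (g ^ p ^ e * h) = g ^ p ^ e * D h := by
  have h1 : ((1 : R) ⊗ₜ[k] (g ^ p ^ e) - (g ^ p ^ e) ⊗ₜ[k] (1 : R)) ∈
      diagonalIdeal k R ^ (i + 1) := by
    have h2 := Ideal.pow_mem_pow (one_tmul_sub_mem_diagonalIdeal (k := k) g) (p ^ e)
    rw [sub_pow_expChar_pow, Algebra.TensorProduct.tmul_pow, Algebra.TensorProduct.tmul_pow,
      one_pow] at h2
    exact Ideal.pow_le_pow_right hi h2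
  have h3 := hD _ (Ideal.mul_mem_right ((1 : R) ⊗ₜ[k] h) _ h1)
  rw [← leftExtension_opCommutator, leftExtension_tmul, one_mul, opCommutator_apply] at h3
  exact sub_eq_zero.mp h3

theorem opCommutator_add (D : R →ₗ[k] R) (a b : R) :
    opCommutator D (a + b) = opCommutator D a + opCommutator D b := by
  ext f
  simp only [opCommutator_apply, LinearMap.add_apply, add_mul, map_add]
  ring

theorem opCommutator_mul (D : R →ₗ[k] R) (a b : R) :
    opCommutator D (a * b) =
      opCommutator D a ∘ₗ LinearMap.mulLeft k b + a • opCommutator D b := by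
  ext f
  simp only [opCommutator_apply, LinearMap.add_apply, LinearMap.comp_apply,
    LinearMap.mulLeft_apply, LinearMap.smul_apply, smul_eq_mul, mul_assoc]
  ring

/-- For a module `N` of operators stable under composition with multiplications, the elements
whose commutator with `D` lies in `N` form a subring. -/
def commutatorSubring (N : Submodule R (R →ₗ[k] R))
    (hN : ∀ E ∈ N, ∀ b, E ∘ₗ LinearMap.mulLeft k b ∈ N) (D : R →ₗ[k] R) : Subring R where
  carrier := {a | opCommutator D a ∈ N}
  mul_mem' := fun {a b} ha hb => by
    rw [Set.mem_ofPred_eq, opCommutator_mul]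
    exact add_mem (hN _ ha b) (N.smul_mem a hb)
  one_mem' := by
    have : opCommutator D 1 = 0 := by ext f; simp [opCommutator_apply]
    rw [Set.mem_ofPred_eq, this]
    exact N.zero_mem
  add_mem' := fun {a b} ha hb => by
    rw [Set.mem_ofPred_eq, opCommutator_add]
    exact add_mem ha hb
  zero_mem' := by
    have : opCommutator D 0 = 0 := by ext f; simp [opCommutator_apply]
    rw [Set.mem_ofPred_eq, this]
    exact N.zero_mem
  neg_mem' := fun {a} ha => by
    have : opCommutator D (-a) = -opCommutator D a := by
      ext f
      simp only [opCommutator_apply, LinearMap.neg_apply, neg_mul, map_neg]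
      ring
    rw [Set.mem_ofPred_eq, this]
    exact neg_mem ha

end DiffOps

/-! ### Orders of the terms of an expansion -/

section Orders

variable {R ι : Type*} [CommRing R] [Fintype ι] [DecidableEq ι]

theorem monom_update (z : ι → R) (α : ι → ℕ) (j : ι) (k : ℕ) :
    monom z (Function.update α j k) = z j ^ k * monom z (Function.update α j 0) := by
  have h : ∀ l, monom z (Function.update α j l) =
      z j ^ l * ∏ i ∈ Finset.univ.erase j, z i ^ α i := by
    intro l
    rw [monom, ← Finset.mul_prod_erase _ _ (Finset.mem_univ j), Function.update_self]
    congr 1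
    refine Finset.prod_congr rfl fun i hi => ?_
    rw [Function.update_of_ne (Finset.ne_of_mem_erase hi)]
  rw [h, h 0, pow_zero, one_mul]

theorem mul_monom_eq_pow_mul (z : ι → R) (α : ι → ℕ) (j : ι) :
    z j * monom z α = z j ^ (α j + 1) * monom z (Function.update α j 0) := by
  conv_lhs => rw [← Function.update_eq_self j α, monom_update]
  rw [pow_succ']
  ring

theorem mul_monom_eq_update (z : ι → R) (α : ι → ℕ) (j : ι) :
    z j * monom z α = monom z (Function.update α j (α j + 1)) := by
  rw [mul_monom_eq_pow_mul, ← monom_update]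

theorem update_mem_expBox {q : ℕ} {α : ι → ℕ} (hα : α ∈ expBox ι q) (j : ι) {k : ℕ} (hk : k < q) :
    Function.update α j k ∈ expBox ι q := by
  rw [mem_expBox] at *
  intro i
  by_cases h : i = j
  · subst h; simpa using hk
  · simpa [h] using hα i

variable {r s : ℕ}

/-- The degree of the `x`-part of an exponent of a monomial in `(x, y)`; it is the order of this
monomial. -/
def xDeg (α : Fin r ⊕ Fin s → ℕ) : ℕ := ∑ i, α (Sum.inl i)

variable (x : Fin r → R) (y : Fin s → R)

theorem monom_mem_pow (α : Fin r ⊕ Fin s → ℕ) :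
    monom (Sum.elim x y) α ∈ Ideal.span (Set.range x) ^ xDeg α := by
  rw [monom, Fintype.prod_sum_type]
  refine Ideal.mul_mem_right _ _ ?_
  rw [xDeg, ← Finset.prod_pow_eq_pow_sum]
  exact Ideal.prod_mem_prod fun i _ =>
    Ideal.pow_mem_pow (Ideal.subset_span (Set.mem_range_self i)) _

theorem pow_mul_monom_mem_pow {q n k : ℕ} {α : Fin r ⊕ Fin s → ℕ} {c : R}
    (hc : c ∈ Ideal.span (Set.range x) ^ k) (hn : n ≤ q * k + xDeg α) :
    c ^ q * monom (Sum.elim x y) α ∈ Ideal.span (Set.range x) ^ n := by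
  have h1 := Ideal.mul_mem_mul (Ideal.pow_mem_pow hc q) (monom_mem_pow x y α)
  rw [← pow_mul, ← pow_add] at h1
  exact Ideal.pow_le_pow_right (by rw [mul_comm k]; exact hn) h1

theorem qSum_mem_pow {q n : ℕ} {c : (Fin r ⊕ Fin s → ℕ) → R}
    (h : ∀ α ∈ expBox (Fin r ⊕ Fin s) q,
      ∃ k, c α ∈ Ideal.span (Set.range x) ^ k ∧ n ≤ q * k + xDeg α) :
    qSum q (Sum.elim x y) c ∈ Ideal.span (Set.range x) ^ n :=
  Ideal.sum_mem _ fun α hα => by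
    obtain ⟨k, hk, hn⟩ := h α hα
    exact pow_mul_monom_mem_pow x y hk hn

variable {x y} {p : ℕ} [ExpChar R p]

theorem xDeg_update_inl_add (α : Fin r ⊕ Fin s → ℕ) (i : Fin r) (k : ℕ) :
    xDeg (Function.update α (Sum.inl i) k) + α (Sum.inl i) = xDeg α + k := by
  have h : ∀ β : Fin r ⊕ Fin s → ℕ, xDeg β =
      β (Sum.inl i) + ∑ j ∈ Finset.univ.erase i, β (Sum.inl j) := fun β =>
    (Finset.add_sum_erase _ (fun j => β (Sum.inl j)) (Finset.mem_univ i)).symm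
  rw [h, h α, Function.update_self]
  have : ∑ j ∈ Finset.univ.erase i, Function.update α (Sum.inl i) k (Sum.inl j) =
      ∑ j ∈ Finset.univ.erase i, α (Sum.inl j) :=
    Finset.sum_congr rfl fun j hj => by
      rw [Function.update_of_ne]
      simpa using Finset.ne_of_mem_erase hj
  rw [this]
  ring

/-- By induction on `n`: multiplication by `x i` raises the `x`-degree of a monomial by one, or
multiplies the coefficient by `x i` when the exponent overflows. -/
theorem exists_qSum_of_mem_pow {e : ℕ} (h : IsQBasis (p ^ e) (Sum.elim x y)) (n : ℕ) :
    ∀ f ∈ Ideal.span (Set.range x) ^ n, ∃ c, f = qSum (p ^ e) (Sum.elim x y) c ∧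
      ∀ α ∈ expBox (Fin r ⊕ Fin s) (p ^ e), xDeg α < n → c α ∈ Ideal.span (Set.range x) := by
  have hq : 0 < p ^ e := pow_pos (expChar_pos R p) e
  have hadd : ∀ (n : ℕ) (f g : R),
      (∃ c, f = qSum (p ^ e) (Sum.elim x y) c ∧
        ∀ α ∈ expBox (Fin r ⊕ Fin s) (p ^ e), xDeg α < n → c α ∈ Ideal.span (Set.range x)) →
      (∃ c, g = qSum (p ^ e) (Sum.elim x y) c ∧
        ∀ α ∈ expBox (Fin r ⊕ Fin s) (p ^ e), xDeg α < n → c α ∈ Ideal.span (Set.range x)) →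
      ∃ c, f + g = qSum (p ^ e) (Sum.elim x y) c ∧
        ∀ α ∈ expBox (Fin r ⊕ Fin s) (p ^ e), xDeg α < n → c α ∈ Ideal.span (Set.range x) := by
    rintro n _ _ ⟨c, rfl, hc⟩ ⟨d, rfl, hd⟩
    exact ⟨c + d, (qSum_add p e _ c d).symm, fun α hα hn => add_mem (hc α hα hn) (hd α hα hn)⟩
  have hzero : ∀ n : ℕ, ∃ c, (0 : R) = qSum (p ^ e) (Sum.elim x y) c ∧
      ∀ α ∈ expBox (Fin r ⊕ Fin s) (p ^ e), xDeg α < n → c α ∈ Ideal.span (Set.range x) :=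
    fun n => ⟨0, by simp [qSum, zero_pow hq.ne'], fun _ _ _ => zero_mem _⟩
  have hsingle : ∀ (n : ℕ) (α : Fin r ⊕ Fin s → ℕ) (g : R), α ∈ expBox (Fin r ⊕ Fin s) (p ^ e) →
      (xDeg α < n → g ∈ Ideal.span (Set.range x)) →
      ∃ c, g ^ p ^ e * monom (Sum.elim x y) α = qSum (p ^ e) (Sum.elim x y) c ∧
        ∀ α ∈ expBox (Fin r ⊕ Fin s) (p ^ e), xDeg α < n → c α ∈ Ideal.span (Set.range x) := by
    intro n α g hα hg
    refine ⟨Pi.single α g, (qSum_single hq.ne' _ hα g).symm, fun β _ hn => ?_⟩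
    by_cases hβ : β = α
    · subst hβ; rw [Pi.single_eq_same]; exact hg hn
    · rw [Pi.single_eq_of_ne hβ]; exact zero_mem _
  induction n with
  | zero =>
    intro f _
    obtain ⟨c, hc⟩ := h.exists_eq_qSum f
    exact ⟨c, hc, fun α _ hn => absurd hn (Nat.not_lt_zero _)⟩
  | succ n ih =>
    intro f hf
    rw [pow_succ'] at hf
    induction hf using Submodule.mul_induction_on' with
    | add f _ g _ hf hg => exact hadd _ _ _ hf hg
    | mem_mul_mem a ha g hg =>
      obtain ⟨t, rfl⟩ := Ideal.mem_span_range_iff_exists_fun.mp ha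
      rw [Finset.sum_mul]
      refine Finset.sum_induction _ _ (hadd (n + 1)) (hzero (n + 1)) fun i _ => ?_
      obtain ⟨c, hc, hcn⟩ := ih (t i * g) (Ideal.mul_mem_left _ _ hg)
      have h1 : t i * x i * g = ∑ α ∈ expBox (Fin r ⊕ Fin s) (p ^ e),
          c α ^ p ^ e * (x i * monom (Sum.elim x y) α) := by
        rw [mul_right_comm, hc, qSum, Finset.sum_mul]
        exact Finset.sum_congr rfl fun α _ => by ring
      rw [h1]
      refine Finset.sum_induction _ _ (hadd (n + 1)) (hzero (n + 1)) fun α hα => ?_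
      have hαi := mem_expBox.mp hα (Sum.inl i)
      rcases Nat.lt_or_ge (α (Sum.inl i) + 1) (p ^ e) with hlt | hge
      · have h2 := mul_monom_eq_update (Sum.elim x y) α (Sum.inl i)
        rw [Sum.elim_inl] at h2
        rw [h2]
        refine hsingle _ _ _ (update_mem_expBox hα _ hlt) fun hn => hcn α hα ?_
        have := xDeg_update_inl_add α i (α (Sum.inl i) + 1)
        omega
      · -- the exponent of `x i` reaches `p ^ e` and is absorbed by the coefficient
        have h2 := mul_monom_eq_pow_mul (Sum.elim x y) α (Sum.inl i)
        rw [Sum.elim_inl, le_antisymm hαi hge] at h2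
        rw [h2, ← mul_assoc, ← mul_pow]
        exact hsingle _ _ _ (update_mem_expBox hα _ hq)
          fun _ => Ideal.mul_mem_left _ _ (Ideal.subset_span ⟨i, rfl⟩)

theorem coeff_mem_of_qSum_mem_pow {e : ℕ} (h : IsQBasis (p ^ e) (Sum.elim x y)) {n : ℕ}
    {c : (Fin r ⊕ Fin s → ℕ) → R}
    (hc : qSum (p ^ e) (Sum.elim x y) c ∈ Ideal.span (Set.range x) ^ n) :
    ∀ α ∈ expBox (Fin r ⊕ Fin s) (p ^ e), xDeg α < n → c α ∈ Ideal.span (Set.range x) := by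
  obtain ⟨d, hd, hdn⟩ := exists_qSum_of_mem_pow h n _ hc
  intro α hα hn
  rw [h.eq_of_qSum_eq hd α hα]
  exact hdn α hα hn

theorem xDeg_add_smul (q : ℕ) (α β : Fin r ⊕ Fin s → ℕ) :
    xDeg (α + q • β) = q * xDeg β + xDeg α := by
  simp [xDeg, Finset.sum_add_distrib, Finset.mul_sum, add_comm]

/-- A `q`-expansion lies in `(x) ^ n` only if all of its terms do, in the form that the order of the
coefficient is large enough. -/
theorem exists_coeff_mem_pow_of_qSum_mem_pow (hp : 1 < p) (h : IsQBasis p (Sum.elim x y)) {e n : ℕ}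
    {c : (Fin r ⊕ Fin s → ℕ) → R}
    (hc : qSum (p ^ e) (Sum.elim x y) c ∈ Ideal.span (Set.range x) ^ n) :
    ∀ α ∈ expBox (Fin r ⊕ Fin s) (p ^ e),
      ∃ k, c α ∈ Ideal.span (Set.range x) ^ k ∧ n ≤ p ^ e * k + xDeg α := by
  intro α hα
  have hq : 0 < p ^ e := pow_pos (expChar_pos R p) e
  have hex : ∃ k, n ≤ p ^ e * k + xDeg α :=
    ⟨n, (Nat.le_mul_of_pos_left n hq).trans (Nat.le_add_right _ _)⟩
  classical
  -- the exponent `k = ⌈(n - xDeg α) / p ^ e⌉`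
  refine ⟨Nat.find hex, ?_, Nat.find_spec hex⟩
  have hkn : Nat.find hex ≤ n :=
    Nat.find_min' hex ((Nat.le_mul_of_pos_left n hq).trans (Nat.le_add_right _ _))
  -- any exponent `n'` with `n ≤ p ^ n'` would serve for the refinement
  obtain ⟨d, hd⟩ := (h.pow n).exists_refinement (q := p ^ e) c
  have hmem : qSum (p ^ (e + n)) (Sum.elim x y) d ∈ Ideal.span (Set.range x) ^ n := by
    rw [pow_add, qSum_mul_eq, ← qSum_congr hd]
    exact hc
  rw [hd α hα]
  refine qSum_mem_pow x y fun β hβ => ?_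
  rcases Nat.lt_or_ge (xDeg β) (Nat.find hex) with hlt | hge
  · refine ⟨1, ?_, ?_⟩
    · rw [pow_one]
      refine coeff_mem_of_qSum_mem_pow (h.pow (e + n)) hmem _ ?_ ?_
      · rw [mem_expBox] at hα hβ ⊢
        intro i
        calc α i + p ^ e * β i < p ^ e + p ^ e * β i := by have := hα i; omega
          _ = p ^ e * (β i + 1) := by ring
          _ ≤ p ^ e * p ^ n := Nat.mul_le_mul_left _ (hβ i)
          _ = p ^ (e + n) := (pow_add _ _ _).symm
      · rw [xDeg_add_smul]
        exact not_le.mp (Nat.find_min hex hlt)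
    · have := Nat.lt_pow_self (n := n) hp
      omega
  · exact ⟨0, by simp, by omega⟩

end Orders

/-! ### Hasse operators -/

section HasseOperators

variable {R ι : Type*} [CommRing R]

/-- The value `(a choose k) * w ^ (a - k)` of the `k`-th Hasse derivative on `w ^ a`. -/
def hasseTerm (w : R) (a k : ℕ) : R := (a.choose k : R) * w ^ (a - k)

theorem hasseTerm_succ_zero (w : R) (a : ℕ) : hasseTerm w (a + 1) 0 = w * hasseTerm w a 0 := by
  simp [hasseTerm, pow_succ']

theorem hasseTerm_succ_succ (w : R) (a k : ℕ) :
    hasseTerm w (a + 1) (k + 1) = hasseTerm w a k + w * hasseTerm w a (k + 1) := by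
  simp only [hasseTerm, Nat.choose_succ_succ, Nat.add_sub_add_right, Nat.cast_add, add_mul]
  congr 1
  rcases Nat.lt_or_ge a (k + 1) with h | h
  · simp [Nat.choose_eq_zero_of_lt h]
  · have : a - k = (a - (k + 1)) + 1 := by omega
    rw [this, pow_succ']
    ring

/-- The `k`-th Hasse derivative, `k < p ^ e`, treats `w ^ p ^ e` as a constant. This makes the Hasse
operators consistent with carrying an overflowing exponent into the coefficient. -/
theorem hasseTerm_prime_pow {p : ℕ} [Fact p.Prime] [CharP R p] (w : R) {e k : ℕ} (hk : k < p ^ e) :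
    hasseTerm w (p ^ e) k = w ^ p ^ e * hasseTerm w 0 k := by
  rcases Nat.eq_zero_or_pos k with rfl | hpos
  · simp [hasseTerm]
  · have h1 : ((p ^ e).choose k : R) = 0 := by
      rw [CharP.cast_eq_zero_iff R p]
      exact (Fact.out : p.Prime).dvd_choose_pow hpos.ne' hk.ne
    simp [hasseTerm, h1, Nat.choose_eq_zero_of_lt hpos]

variable [Fintype ι]

/-- The value `∏ i, (α i choose γ i) * z i ^ (α i - γ i)` of the Hasse operator of multi-index `γ`
on the monomial `z ^ α`. -/
def hasseMonom (z : ι → R) (γ α : ι → ℕ) : R := ∏ i, hasseTerm (z i) (α i) (γ i)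

theorem hasseMonom_eq (z : ι → R) (γ α : ι → ℕ) :
    hasseMonom z γ α = ((∏ i, (α i).choose (γ i) : ℕ) : R) * monom z (α - γ) := by
  simp [hasseMonom, hasseTerm, monom, Finset.prod_mul_distrib]

variable [DecidableEq ι]

theorem hasseMonom_split (z : ι → R) (γ α : ι → ℕ) (j : ι) (a k : ℕ) :
    hasseMonom z (Function.update γ j k) (Function.update α j a) =
      hasseTerm (z j) a k * ∏ i ∈ Finset.univ.erase j, hasseTerm (z i) (α i) (γ i) := by
  rw [hasseMonom, ← Finset.mul_prod_erase _ _ (Finset.mem_univ j)]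
  simp only [Function.update_self]
  congr 1
  refine Finset.prod_congr rfl fun i hi => ?_
  rw [Function.update_of_ne (Finset.ne_of_mem_erase hi),
    Function.update_of_ne (Finset.ne_of_mem_erase hi)]

theorem IsQBasis.linearMap_ext {q : ℕ} {z : ι → R} {D E : R →ₗ[ℤ] R} (h : IsQBasis q z)
    (hD : ∀ g f, D (g ^ q * f) = g ^ q * D f)
    (hE : ∀ g f, E (g ^ q * f) = g ^ q * E f)
    (hDE : ∀ α ∈ expBox ι (q), D (monom z α) = E (monom z α)) : D = E := by
  ext f
  obtain ⟨c, rfl⟩ := h.exists_eq_qSum f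
  rw [qSum, map_sum, map_sum]
  refine Finset.sum_congr rfl fun α hα => ?_
  rw [hD, hE, hDE α hα]

theorem opCommutator_mem_of_forall {q : ℕ} {z : ι → R} (h : IsQBasis q z)
    {N : Submodule R (R →ₗ[ℤ] R)}
    (hN : ∀ E ∈ N, ∀ b, E ∘ₗ LinearMap.mulLeft ℤ b ∈ N) {D : R →ₗ[ℤ] R}
    (hpow : ∀ g, opCommutator D (g ^ q) ∈ N) (hz : ∀ j, opCommutator D (z j) ∈ N) (a : R) :
    opCommutator D a ∈ N := by
  have hpow' : ∀ g, g ^ q ∈ commutatorSubring N hN D := hpow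
  have hz' : ∀ j, z j ∈ commutatorSubring N hN D := hz
  suffices ha : a ∈ commutatorSubring N hN D from ha
  obtain ⟨c, rfl⟩ := h.exists_eq_qSum a
  exact sum_mem fun α _ => mul_mem (hpow' _) (prod_mem fun i _ => pow_mem (hz' i) _)

variable {p : ℕ} [Fact p.Prime] [CharP R p] {e : ℕ} {z : ι → R}

/-- The Hasse operator of multi-index `γ` with respect to `z`: the map that is linear over the
`p ^ e`-th powers and takes the value `hasseMonom z γ α` on the monomials `z ^ α` of the basis. -/
noncomputable def hasseOp (h : IsQBasis (p ^ e) z) (γ : ι → ℕ) : R →ₗ[ℤ] R :=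
  AddMonoidHom.toIntLinearMap <| AddMonoidHom.mk'
    (fun f => ∑ α ∈ expBox ι (p ^ e),
      Classical.choose (h.exists_eq_qSum f) α ^ p ^ e * hasseMonom z γ α)
    fun f g => by
      have hfg := h.eq_of_qSum_eq (c := Classical.choose (h.exists_eq_qSum (f + g)))
        (d := Classical.choose (h.exists_eq_qSum f) + Classical.choose (h.exists_eq_qSum g)) (by
          rw [qSum_add, ← Classical.choose_spec (h.exists_eq_qSum (f + g)),
            ← Classical.choose_spec (h.exists_eq_qSum f),
            ← Classical.choose_spec (h.exists_eq_qSum g)])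
      rw [← Finset.sum_add_distrib]
      refine Finset.sum_congr rfl fun α hα => ?_
      rw [hfg α hα, Pi.add_apply, add_pow_expChar_pow, add_mul]

variable (h : IsQBasis (p ^ e) z) (γ : ι → ℕ)

theorem hasseOp_qSum (c : (ι → ℕ) → R) :
    hasseOp h γ (qSum (p ^ e) z c) =
      ∑ α ∈ expBox ι (p ^ e), c α ^ p ^ e * hasseMonom z γ α := by
  refine Finset.sum_congr rfl fun α hα => ?_
  rw [h.eq_of_qSum_eq (Classical.choose_spec (h.exists_eq_qSum (qSum (p ^ e) z c))).symm α hα]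

theorem hasseOp_pow_mul (g f : R) :
    hasseOp h γ (g ^ p ^ e * f) = g ^ p ^ e * hasseOp h γ f := by
  obtain ⟨c, rfl⟩ := h.exists_eq_qSum f
  have h1 : g ^ p ^ e * qSum (p ^ e) z c = qSum (p ^ e) z fun α => g * c α := by
    simp only [qSum, Finset.mul_sum, mul_pow, mul_assoc]
  rw [h1, hasseOp_qSum, hasseOp_qSum, Finset.mul_sum]
  exact Finset.sum_congr rfl fun α _ => by rw [mul_pow, mul_assoc]

theorem prime_pow_pos (p e : ℕ) [Fact p.Prime] : 0 < p ^ e := pow_pos (Fact.out : p.Prime).pos e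

theorem hasseOp_monom {α : ι → ℕ} (hα : α ∈ expBox ι (p ^ e)) :
    hasseOp h γ (monom z α) = hasseMonom z γ α := by
  have h1 := qSum_single (prime_pow_pos p e).ne' z hα (1 : R)
  rw [one_pow, one_mul] at h1
  rw [← h1, hasseOp_qSum, Finset.sum_eq_single_of_mem α hα]
  · simp
  · intro β _ hβ
    rw [Pi.single_eq_of_ne hβ, zero_pow (prime_pow_pos p e).ne', zero_mul]

theorem hasseOp_one (hγ : γ ≠ 0) : hasseOp h γ 1 = 0 := by
  rw [← monom_zero z, hasseOp_monom h γ (α := 0) (mem_expBox.mpr fun _ => prime_pow_pos p e)]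
  obtain ⟨i, hi⟩ := Function.ne_iff.mp hγ
  refine Finset.prod_eq_zero (Finset.mem_univ i) ?_
  rw [hasseTerm, Pi.zero_apply, Nat.choose_eq_zero_of_lt (Nat.pos_of_ne_zero hi), Nat.cast_zero,
    zero_mul]

variable {γ}

theorem hasseOp_mul_monom (hγ : γ ∈ expBox ι (p ^ e)) {α : ι → ℕ} (hα : α ∈ expBox ι (p ^ e))
    (j : ι) :
    hasseOp h γ (z j * monom z α) = hasseMonom z γ (Function.update α j (α j + 1)) := by
  have hαj := mem_expBox.mp hα j
  rcases Nat.lt_or_ge (α j + 1) (p ^ e) with hlt | hge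
  · rw [mul_monom_eq_update, hasseOp_monom h γ (update_mem_expBox hα _ hlt)]
  · rw [mul_monom_eq_pow_mul, le_antisymm hαj hge, hasseOp_pow_mul,
      hasseOp_monom h γ (update_mem_expBox hα _ (prime_pow_pos p e))]
    have h1 := hasseMonom_split z γ α j
    have h2 := fun a => h1 a (γ j)
    simp only [Function.update_eq_self] at h2
    rw [h2, h2, hasseTerm_prime_pow _ (mem_expBox.mp hγ j), mul_assoc]

theorem opCommutator_hasseOp_pow_mul (a g f : R) :
    opCommutator (hasseOp h γ) a (g ^ p ^ e * f) =
      g ^ p ^ e * opCommutator (hasseOp h γ) a f := by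
  rw [opCommutator_apply, opCommutator_apply, hasseOp_pow_mul, mul_left_comm, hasseOp_pow_mul]
  ring

theorem opCommutator_hasseOp_pow (g : R) : opCommutator (hasseOp h γ) (g ^ p ^ e) = 0 := by
  ext f
  rw [opCommutator_apply, hasseOp_pow_mul, sub_self, LinearMap.zero_apply]

theorem opCommutator_hasseOp_of_eq_zero (hγ : γ ∈ expBox ι (p ^ e)) {j : ι} (hj : γ j = 0) :
    opCommutator (hasseOp h γ) (z j) = 0 := by
  refine h.linearMap_ext (opCommutator_hasseOp_pow_mul h _) (by simp) fun α hα => ?_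
  rw [opCommutator_apply, hasseOp_mul_monom h hγ hα, hasseOp_monom h γ hα, LinearMap.zero_apply,
    sub_eq_zero]
  have h2 := fun a => hasseMonom_split z γ α j a (γ j)
  have h3 := h2 (α j)
  simp only [Function.update_eq_self] at h2 h3
  rw [h2, h3, hj, hasseTerm_succ_zero, mul_assoc]

/-- Pascal's rule for Hasse operators. -/
theorem opCommutator_hasseOp_of_eq_succ (hγ : γ ∈ expBox ι (p ^ e)) {j : ι} {k : ℕ}
    (hj : γ j = k + 1) :
    opCommutator (hasseOp h γ) (z j) = hasseOp h (Function.update γ j k) := by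
  refine h.linearMap_ext (opCommutator_hasseOp_pow_mul h _) (hasseOp_pow_mul h _) fun α hα => ?_
  rw [opCommutator_apply, hasseOp_mul_monom h hγ hα, hasseOp_monom h γ hα, hasseOp_monom h _ hα,
    sub_eq_iff_eq_add]
  have h2 := fun a => hasseMonom_split z γ α j a (γ j)
  have h3 := h2 (α j)
  have h4 := hasseMonom_split z γ α j (α j) k
  simp only [Function.update_eq_self] at h2 h3 h4
  rw [h2, h3, h4, hj, hasseTerm_succ_succ]
  ring

theorem hasseOp_mem_diffOp (n : ℕ) : ∀ γ ∈ expBox ι (p ^ e), ∑ i, γ i = n →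
    hasseOp h γ ∈ diffOp ℤ R n := by
  induction n with
  | zero =>
    intro γ hγ hn
    rw [mem_diffOp_zero_iff]
    intro a
    have hγ0 : ∀ j, γ j = 0 := fun j => (Finset.sum_eq_zero_iff.mp hn) j (Finset.mem_univ j)
    have := opCommutator_mem_of_forall h (N := ⊥) (D := hasseOp h γ)
      (fun E hE b => by rw [Submodule.mem_bot] at *; rw [hE, LinearMap.zero_comp])
      (fun g => by rw [opCommutator_hasseOp_pow]; exact zero_mem _)
      (fun j => by rw [opCommutator_hasseOp_of_eq_zero h hγ (hγ0 j)]; exact zero_mem _) a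
    simpa using this
  | succ n ih =>
    intro γ hγ hn
    rw [mem_diffOp_succ_iff]
    refine opCommutator_mem_of_forall h (fun E hE b => diffOp_comp_mulLeft hE b)
      (fun g => by rw [opCommutator_hasseOp_pow]; exact zero_mem _) fun j => ?_
    rcases hj : γ j with _ | k
    · rw [opCommutator_hasseOp_of_eq_zero h hγ hj]
      exact zero_mem _
    · rw [opCommutator_hasseOp_of_eq_succ h hγ hj]
      have hk := mem_expBox.mp hγ j
      refine ih _ (update_mem_expBox hγ j (by omega)) ?_
      rw [Finset.sum_update_of_mem (Finset.mem_univ j)]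
      rw [← Finset.add_sum_erase _ _ (Finset.mem_univ j), hj] at hn
      rw [Finset.sdiff_singleton_eq_erase]
      omega

end HasseOperators

/-! ### Binomial coefficients modulo a prime -/

section Binomials

theorem choose_mul_add_modEq_one {p : ℕ} (hp : p.Prime) (e k b : ℕ) (hb : b < p ^ e) :
    (p ^ e * k + b).choose b ≡ 1 [MOD p] := by
  induction k with
  | zero => simp [Nat.ModEq.refl]
  | succ k ih =>
    have h1 : p ^ e * (k + 1) + b = p ^ e + (p ^ e * k + b) := by ring
    rw [h1, Nat.add_choose_eq]
    have h0 : (0, b) ∈ Finset.HasAntidiagonal.antidiagonal b := by simp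
    rw [← Finset.add_sum_erase _ _ h0, Nat.choose_zero_right, one_mul]
    refine (Nat.ModEq.add ih (Nat.modEq_zero_iff_dvd.mpr ?_)).trans (by simp [Nat.ModEq.refl])
    refine Finset.dvd_sum fun ij hij => ?_
    obtain ⟨hne, hij⟩ := Finset.mem_erase.mp hij
    rw [Finset.HasAntidiagonal.mem_antidiagonal] at hij
    refine Dvd.dvd.mul_right (hp.dvd_choose_pow ?_ ?_) _
    · intro h
      apply hne
      ext <;> simp <;> omega
    · omega

/-- By Vandermonde's identity, `(∑ α i choose b)` is the sum of the products `∏ (α i choose γ i)` over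
all `γ` with `∑ γ i = b`. -/
theorem exists_not_dvd_prod_choose {ι : Type*} [DecidableEq ι] {p : ℕ} (hp : p.Prime)
    (α : ι → ℕ) (s : Finset ι) :
    ∀ b : ℕ, ¬ p ∣ (∑ i ∈ s, α i).choose b →
      ∃ γ : ι → ℕ, ∑ i ∈ s, γ i = b ∧ ¬ p ∣ ∏ i ∈ s, (α i).choose (γ i) := by
  induction s using Finset.induction_on with
  | empty =>
    intro b hb
    rcases b with _ | b
    · exact ⟨0, by simp, by simpa using hb⟩
    · simp at hb
  | insert j s hj ih =>
    intro b hb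
    rw [Finset.sum_insert hj, Nat.add_choose_eq] at hb
    obtain ⟨⟨u, v⟩, huv, hdvd⟩ : ∃ uv ∈ Finset.HasAntidiagonal.antidiagonal b,
        ¬ p ∣ (α j).choose uv.1 * (∑ i ∈ s, α i).choose uv.2 := by
      by_contra! hcon
      exact hb (Finset.dvd_sum hcon)
    obtain ⟨γ, hγ, hγp⟩ := ih v fun hd => hdvd (hd.mul_left _)
    have hcongr : ∀ i ∈ s, Function.update γ j u i = γ i := fun i hi =>
      Function.update_of_ne (ne_of_mem_of_not_mem hi hj) _ _
    refine ⟨Function.update γ j u, ?_, ?_⟩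
    · rw [Finset.sum_insert hj, Function.update_self, Finset.sum_congr rfl hcongr, hγ]
      exact Finset.HasAntidiagonal.mem_antidiagonal.mp huv
    · rw [Finset.prod_insert hj, Function.update_self,
        Finset.prod_congr rfl fun i hi => by rw [hcongr i hi]]
      exact fun hd => (hp.dvd_mul.mp hd).elim (fun h => hdvd (h.mul_right _)) hγp

end Binomials

/-! ### Orders and the general inequality -/

section NumericalOrders

theorem natCast_le_iSup_iff {P : ℕ → Prop} (h0 : P 0) (hP : ∀ m n, m ≤ n → P n → P m) (n : ℕ) :
    (n : ℕ∞) ≤ ⨆ (m : ℕ) (_ : P m), (m : ℕ∞) ↔ P n := by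
  refine ⟨fun h => ?_, fun h => le_iSup₂ (f := fun (m : ℕ) (_ : P m) => (m : ℕ∞)) n h⟩
  by_contra hn
  have hpos : n ≠ 0 := fun h => hn (h ▸ h0)
  have hle : ⨆ (m : ℕ) (_ : P m), (m : ℕ∞) ≤ ((n - 1 : ℕ) : ℕ∞) := by
    refine iSup₂_le fun m hm => ?_
    have : m < n := not_le.mp fun hnm => hn (hP n m hnm hm)
    exact_mod_cast (by omega : m ≤ n - 1)
  have h1 : n ≤ n - 1 := by exact_mod_cast h.trans hle
  omega

theorem le_natCast_iff_not_succ_le {a : ℕ∞} {n : ℕ} : a ≤ n ↔ ¬ ((n + 1 : ℕ) : ℕ∞) ≤ a := by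
  rw [not_le, Nat.cast_add, Nat.cast_one, ENat.lt_natCast_add_one_iff]

variable {R : Type*} [CommRing R] [IsLocalRing R]

open IsLocalRing

theorem natCast_le_idealOrder_iff {J : Ideal R} {n : ℕ} :
    (n : ℕ∞) ≤ idealOrder J ↔ J ≤ maximalIdeal R ^ n :=
  natCast_le_iSup_iff (by simp) (fun _ _ hmn h => h.trans (Ideal.pow_le_pow_right hmn)) n

theorem natCast_le_elemOrder_iff {f : R} {n : ℕ} :
    (n : ℕ∞) ≤ elemOrder f ↔ f ∈ maximalIdeal R ^ n :=
  natCast_le_iSup_iff (by simp) (fun _ _ hmn h => Ideal.pow_le_pow_right hmn h) n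

theorem elemOrder_eq_natCast_iff {f : R} {n : ℕ} :
    elemOrder f = n ↔ f ∈ maximalIdeal R ^ n ∧ f ∉ maximalIdeal R ^ (n + 1) := by
  rw [← natCast_le_elemOrder_iff, ← natCast_le_elemOrder_iff, ← le_natCast_iff_not_succ_le,
    and_comm, le_antisymm_iff]

theorem natCast_le_qOrder_iff {q : ℕ} {f : R} {n : ℕ} :
    (n : ℕ∞) ≤ qOrder q f ↔ ∃ g : R, ∃ h ∈ maximalIdeal R ^ n, f = g ^ q + h :=
  natCast_le_iSup_iff ⟨0, f - 0 ^ q, by simp, by ring⟩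
    (fun _ _ hmn ⟨g, h, hh, hf⟩ => ⟨g, h, Ideal.pow_le_pow_right hmn hh, hf⟩) n

theorem mem_pow_of_idealOrder_of_mem_diffOpPlus {i n : ℕ} {f : R}
    (h : (n : ℕ∞) ≤ idealOrder (diffPlusIdeal i f)) {D : R →ₗ[ℤ] R} (hD : D ∈ diffOpPlus ℤ R i) :
    D f ∈ maximalIdeal R ^ n :=
  natCast_le_idealOrder_iff.mp h (Ideal.subset_span ⟨D, hD, rfl⟩)

theorem natCast_le_idealOrder_diffPlusIdeal {i n : ℕ} {f : R}
    (h : ∀ D ∈ diffOpPlus ℤ R i, D f ∈ maximalIdeal R ^ n) :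
    (n : ℕ∞) ≤ idealOrder (diffPlusIdeal i f) := by
  rw [natCast_le_idealOrder_iff, diffPlusIdeal, Ideal.span_le]
  rintro _ ⟨D, hD, rfl⟩
  exact h D hD

theorem etaOrder_le {q i : ℕ} (hi : 1 ≤ i) (hiq : i < q) (f : R) :
    etaOrder q f ≤ idealOrder (diffPlusIdeal i f) + i :=
  iInf₂_le i (Finset.mem_Icc.mpr ⟨hi, by omega⟩)

theorem expChar_tensorProduct_int (R : Type*) [CommRing R] (p : ℕ) [ExpChar R p] :
    ExpChar (TensorProduct ℤ R R) p := by
  refine expChar_of_injective_ringHom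
    (f := (Algebra.TensorProduct.includeLeft : R →ₐ[ℤ] TensorProduct ℤ R R).toRingHom) ?_ p
  refine Function.LeftInverse.injective (g := LinearMap.mul' ℤ R) fun a => ?_
  simp

variable {p : ℕ} [Fact p.Prime] [CharP R p] {e : ℕ}

theorem diffOpPlus_apply_pow_add_mem {i n : ℕ} (hi : i < p ^ e) {D : R →ₗ[ℤ] R}
    (hD : D ∈ diffOpPlus ℤ R i) (g : R) {f : R} (hf : f ∈ maximalIdeal R ^ n) :
    D (g ^ p ^ e + f) ∈ maximalIdeal R ^ (n - i) := by
  have := expChar_tensorProduct_int R p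
  have h1 := diffOp_pow_mul p hi hD.1 g 1
  rw [mul_one, hD.2, mul_zero] at h1
  rw [map_add, h1, zero_add]
  exact diffOp_apply_mem_pow _ i n hD.1 f hf

theorem natCast_sub_le_idealOrder {i n : ℕ} (hi : i < p ^ e) {f : R}
    (hf : (n : ℕ∞) ≤ qOrder (p ^ e) f) :
    ((n - i : ℕ) : ℕ∞) ≤ idealOrder (diffPlusIdeal i f) := by
  obtain ⟨g, h, hh, rfl⟩ := natCast_le_qOrder_iff.mp hf
  exact natCast_le_idealOrder_diffPlusIdeal fun D hD => diffOpPlus_apply_pow_add_mem hi hD g hh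

theorem qOrder_le_etaOrder (f : R) : qOrder (p ^ e) f ≤ etaOrder (p ^ e) f := by
  refine le_iInf₂ fun i hi => ENat.forall_natCast_le_iff_le.mp fun n hn => ?_
  rw [Finset.mem_Icc] at hi
  have h1 := natCast_sub_le_idealOrder (p := p) (e := e) (i := i) (by omega) hn
  refine le_trans ?_ (add_le_add_left h1 (i : ℕ∞))
  exact_mod_cast (by omega : n ≤ n - i + i)

end NumericalOrders

/-! ### Hasse operators applied to an expansion -/

section Terms

open IsLocalRing

variable {R : Type*} [CommRing R] {p : ℕ} [Fact p.Prime] [CharP R p] {e r s : ℕ}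
  {x : Fin r → R} {y : Fin s → R}

/-- The coefficients of the expansion of `D_γ f`. The binomial coefficients lie in the prime field, so
they are their own `p ^ e`-th powers. -/
theorem hasseOp_qSum_eq_qSum {ι : Type*} [Fintype ι] [DecidableEq ι] {z : ι → R}
    (h : IsQBasis (p ^ e) z) (γ : ι → ℕ) (c : (ι → ℕ) → R) :
    hasseOp h γ (qSum (p ^ e) z c) = qSum (p ^ e) z fun δ =>
      if δ + γ ∈ expBox ι (p ^ e) then
        ((∏ i, ((δ + γ) i).choose (γ i) : ℕ) : R) * c (δ + γ) else 0 := by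
  have hpow : ∀ n : ℕ, ((n : R)) ^ p ^ e = n := fun n =>
    map_natCast (iterateFrobenius R p e) n
  classical
  rw [hasseOp_qSum, qSum]
  have hL : ∀ α ∈ expBox ι (p ^ e), c α ^ p ^ e * hasseMonom z γ α ≠ 0 → γ ≤ α := by
    intro α _ hne i
    by_contra hlt
    apply hne
    rw [hasseMonom_eq, Finset.prod_eq_zero (Finset.mem_univ i)
      (Nat.choose_eq_zero_of_lt (not_le.mp hlt))]
    simp
  rw [← Finset.sum_filter_of_ne hL]
  have hRt : ∀ δ ∈ expBox ι (p ^ e), (if δ + γ ∈ expBox ι (p ^ e) then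
        ((∏ i, ((δ + γ) i).choose (γ i) : ℕ) : R) * c (δ + γ) else 0) ^ p ^ e * monom z δ ≠ 0 →
      δ + γ ∈ expBox ι (p ^ e) := by
    intro δ _ hne
    by_contra hn
    apply hne
    rw [if_neg hn, zero_pow (prime_pow_pos p e).ne', zero_mul]
  rw [← Finset.sum_filter_of_ne hRt]
  refine Finset.sum_nbij' (fun α => α - γ) (fun δ => δ + γ) ?_ ?_ ?_ ?_ ?_
  · intro α hα
    rw [Finset.mem_filter] at hα ⊢
    refine ⟨mem_expBox.mpr fun i => ?_, ?_⟩
    · exact (Nat.sub_le _ _).trans_lt (mem_expBox.mp hα.1 i)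
    · rw [tsub_add_cancel_of_le hα.2]; exact hα.1
  · intro δ hδ
    rw [Finset.mem_filter] at hδ ⊢
    exact ⟨hδ.2, le_add_self⟩
  · intro α hα
    exact tsub_add_cancel_of_le (Finset.mem_filter.mp hα).2
  · intro δ _
    exact add_tsub_cancel_right _ _
  · intro α hα
    rw [Finset.mem_filter] at hα
    rw [tsub_add_cancel_of_le hα.2, if_pos hα.1, hasseMonom_eq, mul_pow, hpow]
    ring

theorem exists_coeff_mem_pow_of_hasseOp_mem_pow (hz : IsQBasis p (Sum.elim x y)) {n : ℕ}
    {c : (Fin r ⊕ Fin s → ℕ) → R} {α γ : Fin r ⊕ Fin s → ℕ}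
    (hα : α ∈ expBox (Fin r ⊕ Fin s) (p ^ e)) (hγ : ¬ p ∣ ∏ i, (α i).choose (γ i))
    (hmem : hasseOp (hz.pow e) γ (qSum (p ^ e) (Sum.elim x y) c) ∈
      Ideal.span (Set.range x) ^ n) :
    ∃ k, c α ∈ Ideal.span (Set.range x) ^ k ∧ n + xDeg γ ≤ p ^ e * k + xDeg α := by
  have hle : γ ≤ α := by
    intro i
    by_contra hlt
    apply hγ
    rw [Finset.prod_eq_zero (Finset.mem_univ i) (Nat.choose_eq_zero_of_lt (not_le.mp hlt))]
    exact dvd_zero p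
  rw [hasseOp_qSum_eq_qSum] at hmem
  have hbox : α - γ ∈ expBox (Fin r ⊕ Fin s) (p ^ e) :=
    mem_expBox.mpr fun i => (Nat.sub_le _ _).trans_lt (mem_expBox.mp hα i)
  obtain ⟨k, hk, hn⟩ := exists_coeff_mem_pow_of_qSum_mem_pow (Fact.out : p.Prime).one_lt hz hmem
    (α - γ) hbox
  rw [tsub_add_cancel_of_le hle, if_pos hα] at hk
  refine ⟨k, (Ideal.unit_mul_mem_iff_mem _
    ((CharP.isUnit_natCast_iff (Fact.out : p.Prime)).mpr hγ)).mp hk, ?_⟩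
  have hdeg : xDeg (α - γ) + xDeg γ = xDeg α := by
    rw [xDeg, xDeg, ← Finset.sum_add_distrib]
    exact Finset.sum_congr rfl fun i _ => Nat.sub_add_cancel (hle (Sum.inl i))
  omega

variable [IsLocalRing R]

theorem exists_of_elemOrder_eq (hx : Ideal.span (Set.range x) = maximalIdeal R)
    (hz : IsQBasis p (Sum.elim x y)) {N : ℕ} {c : R} {α : Fin r ⊕ Fin s → ℕ}
    (hα : α ∈ expBox (Fin r ⊕ Fin s) (p ^ e))
    (hord : elemOrder (c ^ p ^ e * monom (Sum.elim x y) α) = N) :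
    ∃ k, N = p ^ e * k + xDeg α ∧ c ∈ maximalIdeal R ^ k ∧ c ∉ maximalIdeal R ^ (k + 1) := by
  obtain ⟨h1, h2⟩ := elemOrder_eq_natCast_iff.mp hord
  rw [← hx] at h1 h2 ⊢
  rw [← qSum_single (prime_pow_pos p e).ne' _ hα] at h1
  obtain ⟨k, hk, hn⟩ := exists_coeff_mem_pow_of_qSum_mem_pow (Fact.out : p.Prime).one_lt hz h1 α hα
  rw [Pi.single_eq_same] at hk
  have hN : N = p ^ e * k + xDeg α := by
    by_contra hne
    exact h2 (pow_mul_monom_mem_pow x y hk (by omega))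
  refine ⟨k, hN, hk, fun hk1 => h2 (pow_mul_monom_mem_pow x y hk1 ?_)⟩
  have := prime_pow_pos p e
  rw [mul_add]
  omega

/-- A term of order `N` of the `q`-expansion is moved by a Hasse operator of multi-index `γ` to a
term of order `N - xDeg γ`, provided the binomial coefficients do not vanish. No other term is moved
to the same monomial, so this bounds the order of the value on the whole element. -/
theorem idealOrder_diffPlusIdeal_le (hx : Ideal.span (Set.range x) = maximalIdeal R)
    (hz : IsQBasis p (Sum.elim x y)) {M : ℕ} {c : (Fin r ⊕ Fin s → ℕ) → R}
    {α γ : Fin r ⊕ Fin s → ℕ} (hα : α ∈ expBox (Fin r ⊕ Fin s) (p ^ e))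
    (hγq : γ ∈ expBox (Fin r ⊕ Fin s) (p ^ e)) (hγ0 : γ ≠ 0)
    (hγ : ¬ p ∣ ∏ i, (α i).choose (γ i))
    (hord : elemOrder (c α ^ p ^ e * monom (Sum.elim x y) α) = ((M + xDeg γ : ℕ) : ℕ∞)) {i : ℕ}
    (hi : ∑ j, γ j ≤ i) :
    idealOrder (diffPlusIdeal i (qSum (p ^ e) (Sum.elim x y) c)) ≤ M := by
  rw [le_natCast_iff_not_succ_le]
  intro hle
  have hD : hasseOp (hz.pow e) γ ∈ diffOpPlus ℤ R i :=
    ⟨diffOp_mono hi (hasseOp_mem_diffOp (hz.pow e) _ γ hγq rfl), hasseOp_one (hz.pow e) γ hγ0⟩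
  have hmem := mem_pow_of_idealOrder_of_mem_diffOpPlus hle hD
  rw [← hx] at hmem
  obtain ⟨k', hk', hn⟩ := exists_coeff_mem_pow_of_hasseOp_mem_pow hz hα hγ hmem
  obtain ⟨k, hN, -, hk⟩ := exists_of_elemOrder_eq hx hz hα hord
  rw [hx] at hk'
  have hkk : k' ≤ k := by
    by_contra hlt
    exact hk (Ideal.pow_le_pow_right (by omega) hk')
  have := Nat.mul_le_mul_left (p ^ e) hkk
  omega

theorem term_mem_of_le_qOrder (hx : Ideal.span (Set.range x) = maximalIdeal R)
    (hz : IsQBasis p (Sum.elim x y)) {N : ℕ} {c : (Fin r ⊕ Fin s → ℕ) → R}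
    (hN : (N : ℕ∞) ≤ qOrder (p ^ e) (qSum (p ^ e) (Sum.elim x y) c)) {α : Fin r ⊕ Fin s → ℕ}
    (hα : α ∈ expBox (Fin r ⊕ Fin s) (p ^ e)) (hα0 : α ≠ 0) :
    c α ^ p ^ e * monom (Sum.elim x y) α ∈ maximalIdeal R ^ N := by
  obtain ⟨g, h, hh, hf⟩ := natCast_le_qOrder_iff.mp hN
  have h0 : (0 : Fin r ⊕ Fin s → ℕ) ∈ expBox (Fin r ⊕ Fin s) (p ^ e) :=
    mem_expBox.mpr fun _ => prime_pow_pos p e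
  have h1 := qSum_single (prime_pow_pos p e).ne' (Sum.elim x y) h0 g
  rw [monom_zero, mul_one] at h1
  have h2 : h = qSum (p ^ e) (Sum.elim x y) (c - Pi.single 0 g) := by
    rw [qSum_sub, hf, h1]; ring
  rw [h2, ← hx] at hh
  obtain ⟨k, hk, hn⟩ := exists_coeff_mem_pow_of_qSum_mem_pow (Fact.out : p.Prime).one_lt hz hh α hα
  rw [Pi.sub_apply, Pi.single_eq_of_ne hα0, sub_zero] at hk
  rw [← hx]
  exact pow_mul_monom_mem_pow x y hk hn

theorem exists_elemOrder_eq_qOrder (hx : Ideal.span (Set.range x) = maximalIdeal R)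
    (hz : IsQBasis p (Sum.elim x y)) {N : ℕ} {c : (Fin r ⊕ Fin s → ℕ) → R}
    (hN : qOrder (p ^ e) (qSum (p ^ e) (Sum.elim x y) c) = N) :
    ∃ α ∈ expBox (Fin r ⊕ Fin s) (p ^ e), α ≠ 0 ∧
      elemOrder (c α ^ p ^ e * monom (Sum.elim x y) α) = N := by
  by_contra! hcon
  refine le_natCast_iff_not_succ_le.mp hN.le (natCast_le_qOrder_iff.mpr
    ⟨c 0, _, Ideal.sum_mem _ fun α hα => ?_, qSum_eq_pow_add (prime_pow_pos p e) _ c⟩)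
  obtain ⟨hα0, hα⟩ := Finset.mem_erase.mp hα
  by_contra hnot
  exact hcon α hα hα0 (elemOrder_eq_natCast_iff.mpr
    ⟨term_mem_of_le_qOrder hx hz hN.ge hα hα0, hnot⟩)

end Terms

/-! ### The order of the ideals of values -/

section Cases

open IsLocalRing

variable {R : Type*} [CommRing R] [IsLocalRing R] {p : ℕ} [Fact p.Prime] [CharP R p] {e r s : ℕ}
  {x : Fin r → R} {y : Fin s → R}

theorem idealOrder_eq_of_pos (hx : Ideal.span (Set.range x) = maximalIdeal R)
    (hz : IsQBasis p (Sum.elim x y)) {f : R} {a b : ℕ} (hb : 0 < b) (hbq : b < p ^ e)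
    (hf : qOrder (p ^ e) f = ((p ^ e * a + b : ℕ) : ℕ∞)) :
    idealOrder (diffPlusIdeal b f) = ((p ^ e * a : ℕ) : ℕ∞) ∧
      qOrder (p ^ e) f = etaOrder (p ^ e) f := by
  have hge := natCast_sub_le_idealOrder (p := p) (e := e) (i := b) hbq hf.ge
  rw [Nat.add_sub_cancel] at hge
  have hle : idealOrder (diffPlusIdeal b f) ≤ ((p ^ e * a : ℕ) : ℕ∞) := by
    obtain ⟨c, rfl⟩ := (hz.pow e).exists_eq_qSum f
    obtain ⟨α, hα, -, hord⟩ := exists_elemOrder_eq_qOrder hx hz hf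
    obtain ⟨k, hk, -, -⟩ := exists_of_elemOrder_eq hx hz hα hord
    have hmod : xDeg α % p ^ e = b := by
      have h1 := congrArg (· % p ^ e) hk
      simp only [Nat.mul_add_mod, Nat.mod_eq_of_lt hbq] at h1
      exact h1.symm
    -- `xDeg α = p ^ e * k' + b`, so the binomial coefficient is `1` modulo `p`
    have hdvd : ¬ p ∣ (∑ i, α (Sum.inl i)).choose b := by
      have h1 := choose_mul_add_modEq_one (Fact.out : p.Prime) e (xDeg α / p ^ e) b hbq
      have h2 : p ^ e * (xDeg α / p ^ e) + b = ∑ i, α (Sum.inl i) := by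
        rw [← hmod]; exact Nat.div_add_mod _ _
      rw [h2] at h1
      intro hd
      have h3 := (Nat.modEq_zero_iff_dvd.mpr hd).symm.trans h1
      exact (Fact.out : p.Prime).one_lt.ne' (Nat.dvd_one.mp (Nat.modEq_zero_iff_dvd.mp h3.symm))
    obtain ⟨γ, hγb, hγ⟩ := exists_not_dvd_prod_choose (Fact.out : p.Prime)
      (fun i => α (Sum.inl i)) Finset.univ b hdvd
    have hdeg : xDeg (Sum.elim γ (0 : Fin s → ℕ)) = b := hγb
    refine idealOrder_diffPlusIdeal_le hx hz (γ := Sum.elim γ 0) hα ?_ ?_ ?_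
      (by rw [hdeg]; exact hord) ?_
    · refine mem_expBox.mpr ?_
      rintro (i | j)
      · exact (Finset.single_le_sum (fun _ _ => Nat.zero_le _) (Finset.mem_univ i)).trans_lt
          (hγb ▸ hbq)
      · exact prime_pow_pos p e
    · intro h0
      rw [h0] at hdeg
      simp [xDeg] at hdeg
      omega
    · rw [Fintype.prod_sum_type]
      simpa using hγ
    · rw [Fintype.sum_sum_type]
      simp [hγb]
  refine ⟨le_antisymm hle hge, le_antisymm (qOrder_le_etaOrder f) ?_⟩
  refine (etaOrder_le hb hbq f).trans ?_
  rw [hf]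
  push_cast
  push_cast at hle
  exact add_le_add_left hle _

/-- The bound obtained from the Hasse operator in the single variable `z j` that reduces the exponent
of this variable in the given term to zero; its binomial coefficient is `1`. -/
theorem idealOrder_diffPlusIdeal_le_of_single (hx : Ideal.span (Set.range x) = maximalIdeal R)
    (hz : IsQBasis p (Sum.elim x y)) {M : ℕ} {c : (Fin r ⊕ Fin s → ℕ) → R}
    {α : Fin r ⊕ Fin s → ℕ} (hα : α ∈ expBox (Fin r ⊕ Fin s) (p ^ e)) {j : Fin r ⊕ Fin s}
    (hj : α j ≠ 0)
    (hord : elemOrder (c α ^ p ^ e * monom (Sum.elim x y) α) =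
      ((M + xDeg (Pi.single j (α j) : Fin r ⊕ Fin s → ℕ) : ℕ) : ℕ∞)) {i : ℕ} (hi : α j ≤ i) :
    idealOrder (diffPlusIdeal i (qSum (p ^ e) (Sum.elim x y) c)) ≤ M := by
  refine idealOrder_diffPlusIdeal_le hx hz hα (γ := Pi.single j (α j)) ?_ ?_ ?_ hord ?_
  · refine mem_expBox.mpr fun l => ?_
    by_cases hl : l = j
    · subst hl; simpa using mem_expBox.mp hα l
    · rw [Pi.single_eq_of_ne hl]; exact prime_pow_pos p e
  · simpa using hj
  · rw [Finset.prod_eq_one]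
    · exact (Fact.out : p.Prime).one_lt.ne' ∘ Nat.dvd_one.mp
    · intro l _
      by_cases hl : l = j
      · subst hl; simp
      · rw [Pi.single_eq_of_ne hl, Nat.choose_zero_right]
  · simpa using hi

theorem idealOrder_lt_of_exists_inl (hx : Ideal.span (Set.range x) = maximalIdeal R)
    (hz : IsQBasis p (Sum.elim x y)) {N : ℕ} {c : (Fin r ⊕ Fin s → ℕ) → R}
    (hf : qOrder (p ^ e) (qSum (p ^ e) (Sum.elim x y) c) = N)
    {α : Fin r ⊕ Fin s → ℕ} (hα : α ∈ expBox (Fin r ⊕ Fin s) (p ^ e)) {j : Fin r}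
    (hj : α (Sum.inl j) ≠ 0)
    (hord : elemOrder (c α ^ p ^ e * monom (Sum.elim x y) α) = N) :
    idealOrder (diffPlusIdeal (p ^ e - 1) (qSum (p ^ e) (Sum.elim x y) c)) < N ∧
      qOrder (p ^ e) (qSum (p ^ e) (Sum.elim x y) c) =
        etaOrder (p ^ e) (qSum (p ^ e) (Sum.elim x y) c) := by
  have hlt := mem_expBox.mp hα (Sum.inl j)
  obtain ⟨k, hk, -, -⟩ := exists_of_elemOrder_eq hx hz hα hord
  have hle : α (Sum.inl j) ≤ xDeg α :=
    Finset.single_le_sum (f := fun i => α (Sum.inl i)) (fun _ _ => Nat.zero_le _)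
      (Finset.mem_univ j)
  have hdeg : xDeg (Pi.single (Sum.inl j) (α (Sum.inl j)) : Fin r ⊕ Fin s → ℕ) =
      α (Sum.inl j) := by
    rw [xDeg, Finset.sum_eq_single_of_mem j (Finset.mem_univ j), Pi.single_eq_same]
    intro i _ hi
    exact Pi.single_eq_of_ne (by simpa using hi) _
  have hNt : N - α (Sum.inl j) + α (Sum.inl j) = N := by omega
  have hord' : elemOrder (c α ^ p ^ e * monom (Sum.elim x y) α) = ((N - α (Sum.inl j) +
      xDeg (Pi.single (Sum.inl j) (α (Sum.inl j)) : Fin r ⊕ Fin s → ℕ) : ℕ) : ℕ∞) := by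
    rw [hdeg, hNt, hord]
  refine ⟨?_, le_antisymm (qOrder_le_etaOrder _) ?_⟩
  · refine (idealOrder_diffPlusIdeal_le_of_single hx hz hα hj hord'
      (i := p ^ e - 1) (by omega)).trans_lt ?_
    exact_mod_cast (by omega : N - α (Sum.inl j) < N)
  · refine (etaOrder_le (Nat.pos_of_ne_zero hj) hlt _).trans ?_
    rw [hf]
    refine (add_le_add_left (idealOrder_diffPlusIdeal_le_of_single hx hz hα hj hord' le_rfl)
      _).trans ?_
    exact_mod_cast hNt.le

theorem idealOrder_le_of_forall_inl_eq_zero (hx : Ideal.span (Set.range x) = maximalIdeal R)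
    (hz : IsQBasis p (Sum.elim x y)) {N : ℕ} {c : (Fin r ⊕ Fin s → ℕ) → R}
    (hf : qOrder (p ^ e) (qSum (p ^ e) (Sum.elim x y) c) = N)
    (hc : ∀ α ∈ expBox (Fin r ⊕ Fin s) (p ^ e), α ≠ 0 →
      elemOrder (c α ^ p ^ e * monom (Sum.elim x y) α) = N → ∀ i, α (Sum.inl i) = 0) :
    idealOrder (diffPlusIdeal (p ^ e - 1) (qSum (p ^ e) (Sum.elim x y) c)) ≤ N ∧
      qOrder (p ^ e) (qSum (p ^ e) (Sum.elim x y) c) <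
        etaOrder (p ^ e) (qSum (p ^ e) (Sum.elim x y) c) ∧
      etaOrder (p ^ e) (qSum (p ^ e) (Sum.elim x y) c) < ((N + p ^ e : ℕ) : ℕ∞) := by
  obtain ⟨α, hα, hα0, hord⟩ := exists_elemOrder_eq_qOrder hx hz hf
  have hinl := hc α hα hα0 hord
  obtain ⟨j, hj⟩ : ∃ j, α (Sum.inr j) ≠ 0 := by
    by_contra! hcon
    exact hα0 (funext fun | .inl i => hinl i | .inr j => hcon j)
  have hlt := mem_expBox.mp hα (Sum.inr j)
  have hdeg : xDeg (Pi.single (Sum.inr j) (α (Sum.inr j)) : Fin r ⊕ Fin s → ℕ) = 0 :=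
    Finset.sum_eq_zero fun i _ => Pi.single_eq_of_ne (by simp) _
  have hord' : elemOrder (c α ^ p ^ e * monom (Sum.elim x y) α) = ((N +
      xDeg (Pi.single (Sum.inr j) (α (Sum.inr j)) : Fin r ⊕ Fin s → ℕ) : ℕ) : ℕ∞) := by
    rw [hdeg, add_zero, hord]
  refine ⟨idealOrder_diffPlusIdeal_le_of_single hx hz hα hj hord' (by omega), ?_, ?_⟩
  · rw [hf]
    have hsucc : ((N + 1 : ℕ) : ℕ∞) ≤
        etaOrder (p ^ e) (qSum (p ^ e) (Sum.elim x y) c) := by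
      refine le_iInf₂ fun i hi => ?_
      rw [Finset.mem_Icc] at hi
      have hiq : i < p ^ e := by omega
      have h1 : ((N + 1 - i : ℕ) : ℕ∞) ≤
          idealOrder (diffPlusIdeal i (qSum (p ^ e) (Sum.elim x y) c)) := by
        refine natCast_le_idealOrder_diffPlusIdeal fun D hD => ?_
        have := expChar_tensorProduct_int R p
        have hlin := fun g h => diffOp_pow_mul p hiq hD.1 g h
        have hD1 := hlin (c 0) 1
        rw [mul_one, hD.2, mul_zero] at hD1
        rw [qSum_eq_pow_add (prime_pow_pos p e), map_add, hD1, zero_add, map_sum]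
        refine Ideal.sum_mem _ fun δ hδ => ?_
        obtain ⟨hδ0, hδ⟩ := Finset.mem_erase.mp hδ
        -- a term of order exactly `N` has `x`-degree `0`, so `c δ ^ p ^ e` alone has order `N`
        by_cases hmem : c δ ^ p ^ e * monom (Sum.elim x y) δ ∈ maximalIdeal R ^ (N + 1)
        · exact diffOp_apply_mem_pow _ i (N + 1) hD.1 _ hmem
        · have hδord := elemOrder_eq_natCast_iff.mpr
            ⟨term_mem_of_le_qOrder hx hz hf.ge hδ hδ0, hmem⟩
          have hδinl := hc δ hδ hδ0 hδord
          obtain ⟨k, hk, hck, -⟩ := exists_of_elemOrder_eq hx hz hδ hδord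
          have hδdeg : xDeg δ = 0 := Finset.sum_eq_zero fun i _ => hδinl i
          rw [hlin]
          refine Ideal.mul_mem_right _ _ ?_
          have h2 := Ideal.pow_mem_pow hck (p ^ e)
          rw [← pow_mul] at h2
          refine Ideal.pow_le_pow_right ?_ h2
          rw [mul_comm k]
          omega
      refine le_trans ?_ (add_le_add_left h1 (i : ℕ∞))
      exact_mod_cast (by omega : N + 1 ≤ N + 1 - i + i)
    exact lt_of_lt_of_le (by exact_mod_cast Nat.lt_succ_self N) hsucc
  · refine (etaOrder_le (Nat.pos_of_ne_zero hj) hlt _).trans_lt ?_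
    refine (add_le_add_left (idealOrder_diffPlusIdeal_le_of_single hx hz hα hj hord' le_rfl)
      _).trans_lt ?_
    exact_mod_cast (by omega : N + α (Sum.inr j) < N + p ^ e)

end Cases

/-! ### Expansions indexed by pairs of bounded multi-indices -/

section Transfer

variable {R : Type*} [CommRing R] {q r s : ℕ} {x : Fin r → R} {y : Fin s → R}

theorem elim_mem_expBox (α : Fin r → Fin q) (β : Fin s → Fin q) :
    (Sum.elim (fun i => (α i : ℕ)) fun j => (β j : ℕ)) ∈ expBox (Fin r ⊕ Fin s) q :=
  mem_expBox.mpr fun | .inl i => (α i).isLt | .inr j => (β j).isLt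

theorem exists_elim_eq_of_mem_expBox {δ : Fin r ⊕ Fin s → ℕ} (hδ : δ ∈ expBox (Fin r ⊕ Fin s) q) :
    ∃ (α : Fin r → Fin q) (β : Fin s → Fin q),
      (Sum.elim (fun i => (α i : ℕ)) fun j => (β j : ℕ)) = δ := by
  rw [mem_expBox] at hδ
  exact ⟨fun i => ⟨δ (Sum.inl i), hδ _⟩, fun j => ⟨δ (Sum.inr j), hδ _⟩,
    funext fun | .inl _ => rfl | .inr _ => rfl⟩

/-- A `q`-expansion indexed by pairs of bounded multi-indices is a sum `qSum` for the joint family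
`(x, y)`. -/
theorem IsQExpansion.exists_eq_qSum {f : R} {c : (Fin r → Fin q) → (Fin s → Fin q) → R}
    (h : IsQExpansion x y f c) : ∃ d : (Fin r ⊕ Fin s → ℕ) → R,
      f = qSum q (Sum.elim x y) d ∧ ∀ α β, qTerm x y c α β =
        d (Sum.elim (fun i => (α i : ℕ)) fun j => (β j : ℕ)) ^ q *
          monom (Sum.elim x y) (Sum.elim (fun i => (α i : ℕ)) fun j => (β j : ℕ)) := by
  classical
  let d : (Fin r ⊕ Fin s → ℕ) → R := fun δ =>
    if hδ : δ ∈ expBox (Fin r ⊕ Fin s) q then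
      c (fun i => ⟨δ (Sum.inl i), mem_expBox.mp hδ _⟩)
        (fun j => ⟨δ (Sum.inr j), mem_expBox.mp hδ _⟩) else 0
  have hd : ∀ α β, qTerm x y c α β =
      d (Sum.elim (fun i => (α i : ℕ)) fun j => (β j : ℕ)) ^ q *
        monom (Sum.elim x y) (Sum.elim (fun i => (α i : ℕ)) fun j => (β j : ℕ)) := by
    intro α β
    have h1 : d (Sum.elim (fun i => (α i : ℕ)) fun j => (β j : ℕ)) = c α β :=
      dif_pos (elim_mem_expBox α β)
    rw [h1, qTerm, monom, Fintype.prod_sum_type, mul_assoc]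
    rfl
  refine ⟨d, ?_, hd⟩
  rw [h, qSum, ← Fintype.sum_prod_type']
  refine Finset.sum_bij (fun αβ _ => Sum.elim (fun i => (αβ.1 i : ℕ)) fun j => (αβ.2 j : ℕ))
    (fun αβ _ => elim_mem_expBox αβ.1 αβ.2) ?_ ?_ ?_
  · rintro ⟨α, β⟩ - ⟨α', β'⟩ - heq
    ext i
    · exact congrFun heq (Sum.inl i)
    · exact congrFun heq (Sum.inr i)
  · intro δ hδ
    obtain ⟨α, β, h1⟩ := exists_elim_eq_of_mem_expBox hδ
    exact ⟨(α, β), Finset.mem_univ _, h1⟩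
  · intro αβ _
    exact hd αβ.1 αβ.2

end Transfer

theorem IsRegularParameterSystem.isDomain {R : Type*} [CommRing R] [IsLocalRing R]
    [IsNoetherianRing R] {r : ℕ} {x : Fin r → R} (hx : IsRegularParameterSystem x) :
    IsDomain R := by
  classical
  refine isDomain_of_span_finset_eq_maximalIdeal r R (Finset.univ.image x) ?_ ?_ hx.2.ge
  · exact Finset.card_image_le.trans (by simp)
  · rw [Finset.coe_image, Finset.coe_univ, Set.image_univ, hx.1]

theorem lemma3p11 {R : Type*} [CommRing R] [IsRegularLocalRing R]
    (p : ℕ) [Fact p.Prime] [CharP R p] (hF : (frobenius R p).Finite) (e : ℕ)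
    {r s : ℕ} (x : Fin r → R) (y : Fin s → R) (hxy : IsAdaptedPBasis p x y) (f : R) :
    -- the general inequality
    qOrder (p ^ e) f ≤ etaOrder (p ^ e) f ∧
    ∀ a b : ℕ, b < p ^ e → qOrder (p ^ e) f = ((p ^ e * a + b : ℕ) : ℕ∞) →
      -- Case 1
      (0 < b →
        idealOrder (diffPlusIdeal b f) = ((p ^ e * a : ℕ) : ℕ∞) ∧
        qOrder (p ^ e) f = etaOrder (p ^ e) f) ∧
      (∀ c : (Fin r → Fin (p ^ e)) → (Fin s → Fin (p ^ e)) → R, IsQExpansion x y f c →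
        -- Case 2
        (b = 0 →
          (∃ α β, α ≠ 0 ∧ elemOrder (qTerm x y c α β) = qOrder (p ^ e) f) →
          idealOrder (diffPlusIdeal (p ^ e - 1) f) < ((p ^ e * a : ℕ) : ℕ∞) ∧
          qOrder (p ^ e) f = etaOrder (p ^ e) f) ∧
        -- Case 3
        (b = 0 →
          (∀ α β, ¬ (α = 0 ∧ β = 0) →
            elemOrder (qTerm x y c α β) = qOrder (p ^ e) f → α = 0) →
          idealOrder (diffPlusIdeal (p ^ e - 1) f) ≤ ((p ^ e * a : ℕ) : ℕ∞) ∧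
          qOrder (p ^ e) f < etaOrder (p ^ e) f ∧
          etaOrder (p ^ e) f < ((p ^ e * (a + 1) : ℕ) : ℕ∞))) ∧
      -- the consequences common to the three cases
      qOrder (p ^ e) f ≤ etaOrder (p ^ e) f ∧
      etaOrder (p ^ e) f < ((p ^ e * (a + 1) : ℕ) : ℕ∞) ∧
      (¬ p ^ e ∣ p ^ e * a + b → qOrder (p ^ e) f = etaOrder (p ^ e) f) := by
  have := hxy.1.isDomain
  have hx := hxy.1.1
  have hz : IsQBasis p (Sum.elim x y) := hxy.2.isQBasis
  refine ⟨qOrder_le_etaOrder f, fun a b hb hf => ⟨fun hb0 => idealOrder_eq_of_pos hx hz hb0 hb hf,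
    fun c hc => ⟨?_, ?_⟩, qOrder_le_etaOrder f, ?_, ?_⟩⟩
  · rintro rfl ⟨α, β, hα, hord⟩
    obtain ⟨d, rfl, hd⟩ := hc.exists_eq_qSum
    obtain ⟨j, hj⟩ := Function.ne_iff.mp hα
    rw [hd, hf] at hord
    refine idealOrder_lt_of_exists_inl hx hz hf (elim_mem_expBox α β) (j := j) ?_ hord
    exact fun h => hj (Fin.ext (by simpa using h))
  · rintro rfl hall
    obtain ⟨d, rfl, hd⟩ := hc.exists_eq_qSum
    rw [mul_add, mul_one]
    refine idealOrder_le_of_forall_inl_eq_zero hx hz hf fun δ hδ hδ0 hord i => ?_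
    obtain ⟨α, β, rfl⟩ := exists_elim_eq_of_mem_expBox hδ
    have hα := hall α β ?_ (by rw [hd, hf]; exact hord)
    · simp [hα]
    · rintro ⟨rfl, rfl⟩
      exact hδ0 (funext fun | .inl _ => by simp | .inr _ => by simp)
  · rcases Nat.eq_zero_or_pos b with rfl | hb0
    · obtain ⟨c, rfl⟩ := (hz.pow e).exists_eq_qSum f
      rw [mul_add, mul_one]
      by_cases hcase : ∃ α ∈ expBox (Fin r ⊕ Fin s) (p ^ e), (∃ i, α (Sum.inl i) ≠ 0) ∧
          elemOrder (c α ^ p ^ e * monom (Sum.elim x y) α) = ((p ^ e * a + 0 : ℕ) : ℕ∞)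
      · obtain ⟨α, hα, ⟨j, hj⟩, hord⟩ := hcase
        rw [← (idealOrder_lt_of_exists_inl hx hz hf hα hj hord).2, hf]
        exact_mod_cast Nat.lt_add_of_pos_right (prime_pow_pos p e)
      · push Not at hcase
        refine (idealOrder_le_of_forall_inl_eq_zero hx hz hf fun α hα _ hord i => ?_).2.2
        by_contra hi
        exact hcase α hα ⟨i, hi⟩ hord
    · rw [← (idealOrder_eq_of_pos hx hz hb0 hb hf).2, hf, mul_add, mul_one]
      exact_mod_cast Nat.add_lt_add_left hb _
  · intro hndvd
    refine (idealOrder_eq_of_pos hx hz (Nat.pos_of_ne_zero ?_) hb hf).2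
    rintro rfl
    exact hndvd (by simp)
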